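/- Let $q\in\mathbb{C}^\times$ be not a root of unity, $a\in\mathbb{C}^\times$, $r\in\mathbb{N}$ (with $r=0$ allowed), and put $[n]_q=\frac{q^n-q^{-n}}{q-q^{-1}}$. Let $U_q(\tilde{\mathfrak{sl}}_2)$ be the quantum affine algebra in its second Drinfeld realisation: the associative $\mathbb{C}$-algebra with generators $\mathcal C^{\pm1/2},\mathcal K^{\pm1},\mathcal H_n\ (n\in\mathbb{Z}\setminus\{0\}),\mathcal X^\pm_n\ (n\in\mathbb{Z})$ and relations: $\mathcal C^{\pm1/2}$ are central and mutually inverse, $\mathcal K\mathcal K^{-1}=\mathcal K^{-1}\mathcal K=1$, $[\mathcal K,\mathcal H_n]=0$, $[\mathcal H_n,\mathcal H_m]=\delta_{n,-m}\frac1n[2n]_q\frac{\mathcal C^n-\mathcal C^{-n}}{q-q^{-1}}$, $\mathcal K\mathcal X^\pm_n\mathcal K^{-1}=q^{\pm2}\mathcal X^\pm_n$, $[\mathcal H_n,\mathcal X^\pm_m]=\pm\frac1n[2n]_q\,\mathcal C^{\mp|n|/2}\mathcal X^\pm_{n+m}$, $\mathcal X^\pm_{n+1}\mathcal X^\pm_m-q^{\pm2}\mathcal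 X^\pm_m\mathcal X^\pm_{n+1}=q^{\pm2}\mathcal X^\pm_n\mathcal X^\pm_{m+1}-\mathcal X^\pm_{m+1}\mathcal X^\pm_n$ and $[\mathcal X^+_n,\mathcal X^-_m]=\frac{\mathcal C^{(n-m)/2}\Phi^+_{n+m}-\mathcal C^{-(n-m)/2}\Phi^-_{n+m}}{q-q^{-1}}$, where $$\sum_{n\ge0}\Phi^\pm_{\pm n}u^{\pm n}=\mathcal K^{\pm1}\exp\Big(\pm(q-q^{-1})\sum_{s\ge1}\mathcal H_{\pm s}u^{\pm s}\Big),\qquad \Phi^+_n=\Phi^-_{-n}=0\ \text{ for } n<0.$$ Its Chevalley generators are $K_0=\mathcal C\mathcal K^{-1}$, $X_0^+=\mathcal X^-_1\mathcal K^{-1}$, $X_0^-=\mathcal K\mathcal X^+_{-1}$, $K_1=\mathcal K$, $X_1^\pm=\mathcal X_0^\pm$, together with $K_0^{-1}$, $K_1^{-1}$. Let $V_q(r)$ be the spin $r/2$ representation of $U_q(\mathfrak{sl}_2)$, with basis $v_0,\dots,v_r$ and action $Kv_k=q^{r-2k}v_k$, $x^+v_k=[r-k+1]_qv_{k-1}$,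 $x^-v_k=[k+1]_qv_{k+1}$ ($v_{-1}=v_{r+1}=0$). Then there is exactly one representation $V^{(r)}(a)$ of $U_q(\tilde{\mathfrak{sl}}_2)$ on the vector space $V_q(r)$ in which $\mathcal C^{1/2}$ acts as the identity and the Chevalley generators act through Jimbo's evaluation homomorphism $\mathrm{ev}_a$: $X_0^\pm\mapsto q^{\mp1}a^{\pm1}x^\mp$, $X_1^\pm\mapsto x^\pm$, $K_0^{\pm1}\mapsto K^{\mp1}$, $K_1^{\pm1}\mapsto K^{\pm1}$. It is of type $\mathbf 1$: $\mathcal C^{1/2}$ acts as the identity, and $K_0,K_1$ act semisimply with eigenvalues that are integer powers of $q$. For a representation $V$ and series $\Psi^\pm(u)=\sum_{n\ge0}\psi^\pm_{\pm n}u^{\pm n}\in\mathbb{C}[[u^{\pm1}]]$, let $V_{\Psi}$ be the space of all $v\in V$ for which there is $p\in\mathbb{N}$ with $(\Phi^\pm_{\pm n}-\psi^\pm_{\pm n})^pv=0$ for all $n\ge0$ and both signs; if it is non-zero, it is called a loop-weight space. For polynomials $Q,R\in\mathbb{C}[u]$ with constant term $1$ write $V_{QR^{-1}}$ for $V_\Psi$,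 where $\Psi^+$ and $\Psi^-$ are the expansions about $u=0$ and $u=\infty$, respectively, of $$q^{\deg Q-\deg R}\,\frac{Q(q^{-2}u)R(u)}{Q(u)R(q^{-2}u)};$$ if $V_{QR^{-1}}\ne0$, then $QR^{-1}$ is called its loop-weight. For $0\le k\le r$ put $$Q_{k,a}(u)=\prod_{m=k+1}^{r}(1-q^{r-2m+1}au),\qquad R_{k,a}(u)=\prod_{m=1}^{k}(1-q^{r-2m+3}au),$$ which are polynomials with constant term $1$. Then, for $V=V^{(r)}(a)$: 1. For every $0\le k\le r$, $v_k\neq0$ and $V_{Q_{k,a}R_{k,a}^{-1}}=\mathbb{C}v_k$; so $v_k$ spans a one-dimensional loop-weight space, of loop-weight $Q_{k,a}R_{k,a}^{-1}$. This loop-weight is unique: if $Q,R$ are polynomials with constant term $1$ and $V_{QR^{-1}}=\mathbb{C}v_k$, then $Q/R=Q_{k,a}/R_{k,a}$. 2. These are all the loop-weight spaces: if $V_\Psi\neq0$, then, for some $0\le k\le r$, $\Psi^\pm$ are the expansions of the above rational function with $(Q,R)=(Q_{k,a},R_{k,a})$. 3. $V^{(r)}(a)$ is irreducible, and its Drinfeld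 polynomial is $\prod_{k=1}^{r}(1-q^{r-2k+1}au)$. That is, this is the unique polynomial $P$ with constant term $1$ such that, for some highest weight vector $v$ (a non-zero vector that generates $V$, is annihilated by all $\mathcal X^+_n$ and is a simultaneous eigenvector of $\mathcal K$ and all $\mathcal H_n$), the eigenvalues of the $\Phi^+_n$ and of the $\Phi^-_{-n}$, $n\ge0$, on $v$ are the coefficients of $u^n$, respectively $u^{-n}$, in the expansions of $q^{\deg P}P(q^{-2}u)/P(u)$ about $0$ and $\infty$, respectively. -/

import Mathlib

open Polynomial

noncomputable section

namespace QAff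

/-- The `q`-number `[n]_q = (q^n - q^{-n}) / (q - q^{-1})`. -/
def qInt (q : ℂˣ) (n : ℤ) : ℂ :=
  ((q : ℂ) ^ n - (q : ℂ) ^ (-n)) / ((q : ℂ) - (q : ℂ)⁻¹)

/-! ### The algebra `U_q(sl_2)` and its spin `r/2` representation -/

/-- Generators `K, K⁻¹, x⁺, x⁻` of `U_q(sl_2)`. -/
inductive Sl2Gen : Type
  | K | Kinv | xp | xm

/-- The free algebra on the generators of `U_q(sl_2)`. -/
abbrev Sl2Free : Type := FreeAlgebra ℂ Sl2Gen

/-- A generator of `U_q(sl_2)` as an element of the free algebra. -/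
def sl2Free (g : Sl2Gen) : Sl2Free := FreeAlgebra.ι ℂ g

/-- Defining relations of `U_q(sl_2)`. -/
inductive Sl2Rel (q : ℂˣ) : Sl2Free → Sl2Free → Prop
  | K_mul_Kinv : Sl2Rel q (sl2Free .K * sl2Free .Kinv) 1
  | Kinv_mul_K : Sl2Rel q (sl2Free .Kinv * sl2Free .K) 1
  | K_xp : Sl2Rel q (sl2Free .K * sl2Free .xp * sl2Free .Kinv)
      ((q : ℂ) ^ (2 : ℤ) • sl2Free .xp)
  | K_xm : Sl2Rel q (sl2Free .K * sl2Free .xm * sl2Free .Kinv)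
      ((q : ℂ) ^ (-2 : ℤ) • sl2Free .xm)
  | xp_xm : Sl2Rel q (sl2Free .xp * sl2Free .xm - sl2Free .xm * sl2Free .xp)
      (((q : ℂ) - (q : ℂ)⁻¹)⁻¹ • (sl2Free .K - sl2Free .Kinv))

/-- The quantum group `U_q(sl_2)` over `ℂ`. -/
abbrev UqSl2 (q : ℂˣ) : Type := RingQuot (Sl2Rel q)

/-- A generator of `U_q(sl_2)`. -/
def sl2Gen (q : ℂˣ) (g : Sl2Gen) : UqSl2 q := RingQuot.mkAlgHom ℂ (Sl2Rel q) (sl2Free g)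

/-- The underlying `(r+1)`-dimensional space of the spin `r/2` representation. -/
abbrev SpinSpace (r : ℕ) : Type := Fin (r + 1) → ℂ

/-- The vectors `v_j`, with the convention `v_j = 0` for `j > r`. -/
def spinVec (r : ℕ) (j : ℕ) : SpinSpace r :=
  if h : j < r + 1 then Pi.single ⟨j, h⟩ 1 else 0

/-- The action of the generators of `U_q(sl_2)` on the basis `v_0, …, v_r`:
`K v_k = q^{r-2k} v_k`, `x⁺ v_k = [r-k+1] v_{k-1}`, `x⁻ v_k = [k+1] v_{k+1}`,
where `v_{-1} = v_{r+1} = 0`. -/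
def spinGen (q : ℂˣ) (r : ℕ) : Sl2Gen → Module.End ℂ (SpinSpace r)
  | .K => (Pi.basisFun ℂ (Fin (r + 1))).constr ℂ
      fun k => (q : ℂ) ^ ((r : ℤ) - 2 * (k : ℕ)) • spinVec r k
  | .Kinv => (Pi.basisFun ℂ (Fin (r + 1))).constr ℂ
      fun k => (q : ℂ) ^ (-((r : ℤ) - 2 * (k : ℕ))) • spinVec r k
  | .xp => (Pi.basisFun ℂ (Fin (r + 1))).constr ℂ
      fun k => if (k : ℕ) = 0 then 0 else
        qInt q ((r : ℤ) - (k : ℕ) + 1) • spinVec r ((k : ℕ) - 1)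
  | .xm => (Pi.basisFun ℂ (Fin (r + 1))).constr ℂ
      fun k => qInt q (((k : ℕ) : ℤ) + 1) • spinVec r ((k : ℕ) + 1)

theorem spinVec_eq_zero {r j : ℕ} (h : ¬ j < r + 1) : spinVec r j = 0 := by
  simp [spinVec, h]

theorem spinVec_eq_basis {r j : ℕ} (h : j < r + 1) :
    spinVec r j = Pi.basisFun ℂ (Fin (r + 1)) ⟨j, h⟩ := by
  simp [spinVec, h]

theorem spinGen_K (q : ℂˣ) (r j : ℕ) :
    spinGen q r .K (spinVec r j) = (q : ℂ) ^ ((r : ℤ) - 2 * j) • spinVec r j := by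
  by_cases h : j < r + 1
  · rw [spinVec_eq_basis h, spinGen, Module.Basis.constr_basis, ← spinVec_eq_basis h]
  · simp [spinVec_eq_zero h]

theorem spinGen_Kinv (q : ℂˣ) (r j : ℕ) :
    spinGen q r .Kinv (spinVec r j) = (q : ℂ) ^ (-((r : ℤ) - 2 * j)) • spinVec r j := by
  by_cases h : j < r + 1
  · rw [spinVec_eq_basis h, spinGen, Module.Basis.constr_basis, ← spinVec_eq_basis h]
  · simp [spinVec_eq_zero h]

theorem spinGen_xm (q : ℂˣ) (r j : ℕ) :
    spinGen q r .xm (spinVec r j) = qInt q ((j : ℤ) + 1) • spinVec r (j + 1) := by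
  by_cases h : j < r + 1
  · rw [spinVec_eq_basis h, spinGen, Module.Basis.constr_basis]
  · have h' : ¬ j + 1 < r + 1 := by omega
    simp [spinVec_eq_zero h, spinVec_eq_zero h']

theorem spinGen_xp_zero (q : ℂˣ) (r : ℕ) : spinGen q r .xp (spinVec r 0) = 0 := by
  rw [spinVec_eq_basis (Nat.succ_pos r), spinGen, Module.Basis.constr_basis]
  simp

theorem spinGen_xp_succ (q : ℂˣ) (r j : ℕ) :
    spinGen q r .xp (spinVec r (j + 1)) = qInt q ((r : ℤ) - j) • spinVec r j := by
  by_cases h : j + 1 < r + 1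
  · rw [spinVec_eq_basis h, spinGen, Module.Basis.constr_basis]
    have e : (r : ℤ) - ((j : ℤ) + 1) + 1 = r - j := by ring
    simp [e]
  · rw [spinVec_eq_zero h, map_zero]
    by_cases h' : j < r + 1
    · have : j = r := by omega
      subst this
      simp [qInt]
    · simp [spinVec_eq_zero h']

theorem spin_ext {r : ℕ} {f g : Module.End ℂ (SpinSpace r)}
    (h : ∀ j < r + 1, f (spinVec r j) = g (spinVec r j)) : f = g := by
  apply (Pi.basisFun ℂ (Fin (r + 1))).ext
  rintro ⟨j, hj⟩
  rw [← spinVec_eq_basis hj]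
  exact h j hj

theorem spin_rel (q : ℂˣ) (r : ℕ) ⦃x y : Sl2Free⦄ (h : Sl2Rel q x y) :
    FreeAlgebra.lift ℂ (spinGen q r) x = FreeAlgebra.lift ℂ (spinGen q r) y := by
  have hq : (q : ℂ) ≠ 0 := q.ne_zero
  cases h with
  | K_mul_Kinv =>
    apply spin_ext; intro j hj
    simp only [sl2Free, map_mul, FreeAlgebra.lift_ι_apply, Module.End.mul_apply, map_one,
      Module.End.one_apply, spinGen_K, spinGen_Kinv, map_smul, smul_smul]
    rw [← zpow_add₀ hq]; simp
  | Kinv_mul_K =>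
    apply spin_ext; intro j hj
    simp only [sl2Free, map_mul, FreeAlgebra.lift_ι_apply, Module.End.mul_apply, map_one,
      Module.End.one_apply, spinGen_K, spinGen_Kinv, map_smul, smul_smul]
    rw [← zpow_add₀ hq]; simp
  | K_xp =>
    apply spin_ext; intro j hj
    simp only [sl2Free, map_mul, FreeAlgebra.lift_ι_apply, Module.End.mul_apply, map_smul,
      LinearMap.smul_apply, spinGen_Kinv]
    rcases j with _ | j
    · simp [spinGen_xp_zero]
    · rw [spinGen_xp_succ, map_smul, spinGen_K, smul_smul, smul_smul, smul_smul,
        mul_right_comm, mul_comm, ← zpow_add₀ hq, mul_comm]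
      congr 3
      push_cast; ring
  | K_xm =>
    apply spin_ext; intro j hj
    simp only [sl2Free, map_mul, FreeAlgebra.lift_ι_apply, Module.End.mul_apply, map_smul,
      LinearMap.smul_apply, spinGen_Kinv, spinGen_xm, spinGen_K, smul_smul]
    rw [mul_left_comm, ← zpow_add₀ hq, mul_comm]
    congr 3
    push_cast; ring
  | xp_xm =>
    apply spin_ext; intro j hj
    simp only [sl2Free, map_sub, map_mul, FreeAlgebra.lift_ι_apply, Module.End.mul_apply, map_smul,
      LinearMap.smul_apply, LinearMap.sub_apply, spinGen_Kinv, spinGen_xm, spinGen_K,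
      spinGen_xp_succ, smul_smul]
    have key : ∀ s t : ℤ, qInt q (s + 1) * qInt q (t - s) - qInt q s * qInt q (t - s + 1)
        = ((q : ℂ) - (q : ℂ)⁻¹)⁻¹ * ((q : ℂ) ^ (t - 2 * s) - (q : ℂ) ^ (-(t - 2 * s))) := by
      intro s t
      by_cases h0 : (q : ℂ) - (q : ℂ)⁻¹ = 0
      · simp [qInt, h0]
      · have e1 : (q : ℂ) ^ (s + 1) = (q : ℂ) ^ s * q := zpow_add_one₀ hq s
        have e2 : (q : ℂ) ^ (-(s + 1)) = ((q : ℂ) ^ s)⁻¹ * (q : ℂ)⁻¹ := by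
          rw [zpow_neg, e1, mul_inv]
        have e3 : (q : ℂ) ^ (t - s) = (q : ℂ) ^ t * ((q : ℂ) ^ s)⁻¹ := by
          rw [zpow_sub₀ hq]; rfl
        have e4 : (q : ℂ) ^ (-(t - s)) = ((q : ℂ) ^ t)⁻¹ * (q : ℂ) ^ s := by
          rw [zpow_neg, e3, mul_inv, inv_inv]
        have e5 : (q : ℂ) ^ (t - s + 1) = (q : ℂ) ^ t * ((q : ℂ) ^ s)⁻¹ * q := by
          rw [zpow_add_one₀ hq, e3]
        have e6 : (q : ℂ) ^ (-(t - s + 1)) = ((q : ℂ) ^ t)⁻¹ * (q : ℂ) ^ s * (q : ℂ)⁻¹ := by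
          rw [zpow_neg, e5, mul_inv, mul_inv, inv_inv]
        have e7 : (q : ℂ) ^ (t - 2 * s) = (q : ℂ) ^ t * ((q : ℂ) ^ s)⁻¹ * ((q : ℂ) ^ s)⁻¹ := by
          rw [show t - 2 * s = (t - s) - s by ring, zpow_sub₀ hq, e3]; rfl
        have e8 : (q : ℂ) ^ (-(t - 2 * s)) = ((q : ℂ) ^ t)⁻¹ * (q : ℂ) ^ s * (q : ℂ) ^ s := by
          rw [zpow_neg, e7, mul_inv, mul_inv, inv_inv]
        have e9 : (q : ℂ) ^ (-s) = ((q : ℂ) ^ s)⁻¹ := zpow_neg _ _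
        simp only [qInt, e1, e2, e3, e4, e5, e6, e7, e8, e9]
        have hs : (q : ℂ) ^ s ≠ 0 := zpow_ne_zero _ hq
        have ht : (q : ℂ) ^ t ≠ 0 := zpow_ne_zero _ hq
        generalize (q : ℂ) ^ s = S at *
        generalize (q : ℂ) ^ t = T at *
        rw [div_mul_div_comm, div_mul_div_comm, ← sub_div, div_eq_iff (mul_ne_zero h0 h0)]
        have : ∀ d X : ℂ, d ≠ 0 → d⁻¹ * X * (d * d) = X * d := by
          intro d X hd; field_simp
        rw [this _ _ h0]
        field_simp
        ring
    rcases j with _ | j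
    · rw [spinGen_xp_zero]
      have := key 0 r
      simp only [map_zero, sub_zero, ← sub_smul, smul_smul]
      congr 1
      simpa [qInt] using this
    · rw [spinGen_xp_succ, map_smul, spinGen_xm, smul_smul, ← sub_smul, ← sub_smul, smul_smul]
      congr 1
      have := key ((j : ℤ) + 1) r
      rw [show (r : ℤ) - (j + 1) + 1 = r - j by ring] at this
      push_cast
      linear_combination this

/-- The spin `r/2` (type `1`) representation `V_q(r)` of `U_q(sl_2)`. -/
def spinRep (q : ℂˣ) (r : ℕ) : UqSl2 q →ₐ[ℂ] Module.End ℂ (SpinSpace r) :=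
  RingQuot.liftAlgHom ℂ ⟨FreeAlgebra.lift ℂ (spinGen q r), spin_rel q r⟩

/-! ### The quantum affine algebra of `sl_2` in its second Drinfeld (loop) realisation -/

/-- Generators `C^{1/2}, C^{-1/2}, K, K⁻¹, H_r (r ≠ 0), X⁺_s, X⁻_s`. -/
inductive LoopGen : Type
  | Chalf | ChalfInv | K | Kinv
  | H (r : ℤ) (hr : r ≠ 0)
  | Xp (s : ℤ)
  | Xm (s : ℤ)

/-- The free algebra on the loop generators. -/
abbrev LoopFree : Type := FreeAlgebra ℂ LoopGen

/-- A loop generator as an element of the free algebra. -/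
def loopFree (g : LoopGen) : LoopFree := FreeAlgebra.ι ℂ g

/-- `C^{n/2}` for an integer `n`. -/
def cHalfPow (n : ℤ) : LoopFree :=
  if 0 ≤ n then loopFree .Chalf ^ n.toNat else loopFree .ChalfInv ^ (-n).toNat

/-- For a power series `x` with zero constant term over a `ℂ`-algebra, the coefficient of `u^n`
in `exp x = ∑ x^m / m!` (the terms with `m > n` do not contribute). -/
def expCoeff {A : Type*} [Ring A] [Algebra ℂ A] (x : PowerSeries A) (n : ℕ) : A :=
  ∑ m ∈ Finset.range (n + 1), (m.factorial : ℂ)⁻¹ • PowerSeries.coeff n (x ^ m)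

/-- The series `∑_{s ≥ 1} H_s u^s`. -/
def hSeriesPlus : PowerSeries LoopFree :=
  PowerSeries.mk fun s => if h : s = 0 then 0 else loopFree (.H (s : ℤ) (by omega))

/-- The series `∑_{s ≥ 1} H_{-s} u^{-s}`, as a power series in `u^{-1}`. -/
def hSeriesMinus : PowerSeries LoopFree :=
  PowerSeries.mk fun s => if h : s = 0 then 0 else loopFree (.H (-(s : ℤ)) (by omega))

/-- `Φ⁺_n`, the coefficient of `u^n` in `K exp((q - q⁻¹) ∑_{s ≥ 1} H_s u^s)`. It vanishes for
`n < 0`. -/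
def phiPlusFree (q : ℂˣ) (n : ℤ) : LoopFree :=
  if n < 0 then 0 else
    loopFree .K * expCoeff (((q : ℂ) - (q : ℂ)⁻¹) • hSeriesPlus) n.toNat

/-- `Φ⁻_n`, the coefficient of `u^n` in `K⁻¹ exp(-(q - q⁻¹) ∑_{s ≥ 1} H_{-s} u^{-s})`. It vanishes
for `n > 0`. -/
def phiMinusFree (q : ℂˣ) (n : ℤ) : LoopFree :=
  if 0 < n then 0 else
    loopFree .Kinv * expCoeff ((-((q : ℂ) - (q : ℂ)⁻¹)) • hSeriesMinus) (-n).toNat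

/-- Defining relations of the quantum affine algebra of `sl_2` in the second Drinfeld realisation.
(There are no Serre relations in rank one.) -/
inductive LoopRel (q : ℂˣ) : LoopFree → LoopFree → Prop
  | K_mul_Kinv : LoopRel q (loopFree .K * loopFree .Kinv) 1
  | Kinv_mul_K : LoopRel q (loopFree .Kinv * loopFree .K) 1
  | C_mul_Cinv : LoopRel q (loopFree .Chalf * loopFree .ChalfInv) 1
  | C_central (g : LoopGen) :
      LoopRel q (loopFree .Chalf * loopFree g) (loopFree g * loopFree .Chalf)
  | Cinv_central (g : LoopGen) :
      LoopRel q (loopFree .ChalfInv * loopFree g) (loopFree g * loopFree .ChalfInv)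
  | K_H (n : ℤ) (hn : n ≠ 0) :
      LoopRel q (loopFree .K * loopFree (.H n hn)) (loopFree (.H n hn) * loopFree .K)
  | H_H (n m : ℤ) (hn : n ≠ 0) (hm : m ≠ 0) :
      LoopRel q
        (loopFree (.H n hn) * loopFree (.H m hm) - loopFree (.H m hm) * loopFree (.H n hn))
        (if n = -m then
          ((1 / (n : ℂ)) * qInt q (2 * n) * ((q : ℂ) - (q : ℂ)⁻¹)⁻¹) •
            (cHalfPow (2 * n) - cHalfPow (-(2 * n)))
        else 0)
  | K_Xp (n : ℤ) :
      LoopRel q (loopFree .K * loopFree (.Xp n) * loopFree .Kinv)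
        ((q : ℂ) ^ (2 : ℤ) • loopFree (.Xp n))
  | K_Xm (n : ℤ) :
      LoopRel q (loopFree .K * loopFree (.Xm n) * loopFree .Kinv)
        ((q : ℂ) ^ (-2 : ℤ) • loopFree (.Xm n))
  | H_Xp (n m : ℤ) (hn : n ≠ 0) :
      LoopRel q (loopFree (.H n hn) * loopFree (.Xp m) - loopFree (.Xp m) * loopFree (.H n hn))
        (((1 / (n : ℂ)) * qInt q (2 * n)) • (cHalfPow (-|n|) * loopFree (.Xp (n + m))))
  | H_Xm (n m : ℤ) (hn : n ≠ 0) :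
      LoopRel q (loopFree (.H n hn) * loopFree (.Xm m) - loopFree (.Xm m) * loopFree (.H n hn))
        ((-((1 / (n : ℂ)) * qInt q (2 * n))) • (cHalfPow |n| * loopFree (.Xm (n + m))))
  | Xp_Xp (n m : ℤ) :
      LoopRel q
        (loopFree (.Xp (n + 1)) * loopFree (.Xp m)
          - (q : ℂ) ^ (2 : ℤ) • (loopFree (.Xp m) * loopFree (.Xp (n + 1))))
        ((q : ℂ) ^ (2 : ℤ) • (loopFree (.Xp n) * loopFree (.Xp (m + 1)))
          - loopFree (.Xp (m + 1)) * loopFree (.Xp n))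
  | Xm_Xm (n m : ℤ) :
      LoopRel q
        (loopFree (.Xm (n + 1)) * loopFree (.Xm m)
          - (q : ℂ) ^ (-2 : ℤ) • (loopFree (.Xm m) * loopFree (.Xm (n + 1))))
        ((q : ℂ) ^ (-2 : ℤ) • (loopFree (.Xm n) * loopFree (.Xm (m + 1)))
          - loopFree (.Xm (m + 1)) * loopFree (.Xm n))
  | Xp_Xm (n m : ℤ) :
      LoopRel q
        (loopFree (.Xp n) * loopFree (.Xm m) - loopFree (.Xm m) * loopFree (.Xp n))
        (((q : ℂ) - (q : ℂ)⁻¹)⁻¹ •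
          (cHalfPow (n - m) * phiPlusFree q (n + m)
            - cHalfPow (-(n - m)) * phiMinusFree q (n + m)))

/-- The quantum affine algebra `U_q` of affine `sl_2` (without derivation), in its second Drinfeld
realisation. -/
abbrev UqAff (q : ℂˣ) : Type := RingQuot (LoopRel q)

/-- The quotient map from the free algebra. -/
def toUqAff (q : ℂˣ) : LoopFree →ₐ[ℂ] UqAff q := RingQuot.mkAlgHom ℂ (LoopRel q)

/-- A loop generator of the quantum affine algebra. -/
def loopGen (q : ℂˣ) (g : LoopGen) : UqAff q := toUqAff q (loopFree g)

/-- The element `Φ⁺_n` of the quantum affine algebra. -/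
def phiPlus (q : ℂˣ) (n : ℤ) : UqAff q := toUqAff q (phiPlusFree q n)

/-- The element `Φ⁻_n` of the quantum affine algebra. -/
def phiMinus (q : ℂˣ) (n : ℤ) : UqAff q := toUqAff q (phiMinusFree q n)

/-! ### Chevalley generators and evaluation representations -/

/-- Names of the Chevalley generators `K_i, K_i⁻¹, X_i⁺, X_i⁻`, `i = 0, 1`. -/
inductive ChevGen : Type
  | K0 | K0inv | X0p | X0m | K1 | K1inv | X1p | X1m

/-- The Chevalley generators in terms of the loop generators:
`K_0 = C K⁻¹`, `X_0⁺ = X⁻_1 K⁻¹`, `X_0⁻ = K X⁺_{-1}`, `K_1 = K`, `X_1^± = X^±_0`. -/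
def chevalley (q : ℂˣ) : ChevGen → UqAff q
  | .K0 => loopGen q .Chalf * loopGen q .Chalf * loopGen q .Kinv
  | .K0inv => loopGen q .K * loopGen q .ChalfInv * loopGen q .ChalfInv
  | .X0p => loopGen q (.Xm 1) * loopGen q .Kinv
  | .X0m => loopGen q .K * loopGen q (.Xp (-1))
  | .K1 => loopGen q .K
  | .K1inv => loopGen q .Kinv
  | .X1p => loopGen q (.Xp 0)
  | .X1m => loopGen q (.Xm 0)

/-- The values of Jimbo's evaluation homomorphism `ev_a` on the Chevalley generators:
`X_0⁺ ↦ q⁻¹ a x⁻`, `X_0⁻ ↦ q a⁻¹ x⁺`, `X_1^± ↦ x^±`, `K_0 ↦ K⁻¹`, `K_1 ↦ K`. -/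
def jimboEv (q a : ℂˣ) : ChevGen → UqSl2 q
  | .K0 => sl2Gen q .Kinv
  | .K0inv => sl2Gen q .K
  | .X0p => ((q : ℂ)⁻¹ * (a : ℂ)) • sl2Gen q .xm
  | .X0m => ((q : ℂ) * (a : ℂ)⁻¹) • sl2Gen q .xp
  | .K1 => sl2Gen q .K
  | .K1inv => sl2Gen q .Kinv
  | .X1p => sl2Gen q .xp
  | .X1m => sl2Gen q .xm

/-- `ρ` is the evaluation representation `V^{(r)}(a)`, i.e. the pull-back of the spin `r/2`
representation of `U_q(sl_2)` by Jimbo's homomorphism `ev_a`, regarded as a representation of the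
quantum affine algebra with `C^{1/2}` acting as the identity. -/
structure IsEvaluationRep (q a : ℂˣ) (r : ℕ)
    (ρ : UqAff q →ₐ[ℂ] Module.End ℂ (SpinSpace r)) : Prop where
  Chalf : ρ (loopGen q .Chalf) = 1
  chevalley : ∀ g : ChevGen, ρ (chevalley q g) = spinRep q r (jimboEv q a g)

/-! ### Representations of the quantum affine algebra -/

section Rep

variable {q : ℂˣ} {V : Type*} [AddCommGroup V] [Module ℂ V]

/-- Type `1` representations: `C^{1/2}` acts as the identity, and `K_0`, `K_1` act semisimply with
eigenvalues that are integer powers of `q`. -/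
structure IsTypeOne (ρ : UqAff q →ₐ[ℂ] Module.End ℂ V) : Prop where
  Chalf : ρ (loopGen q .Chalf) = 1
  K0 : ⨆ n : ℤ, Module.End.eigenspace (ρ (chevalley q .K0)) ((q : ℂ) ^ n) = ⊤
  K1 : ⨆ n : ℤ, Module.End.eigenspace (ρ (chevalley q .K1)) ((q : ℂ) ^ n) = ⊤

/-- Irreducibility: non-zero, and no invariant subspaces other than `0` and `V`. -/
structure IsIrreducibleRep (ρ : UqAff q →ₐ[ℂ] Module.End ℂ V) : Prop where
  nontrivial : Nontrivial V
  eq_bot_or_eq_top : ∀ W : Submodule ℂ V,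
    (∀ x : UqAff q, ∀ w ∈ W, ρ x w ∈ W) → W = ⊥ ∨ W = ⊤

/-- The common generalised eigenspace of the `Φ⁺_n` and `Φ⁻_{-n}`, `n ≥ 0`, with generalised
eigenvalues the coefficients of `Ψ⁺(u) = ∑ ψ⁺_n u^n` and of `Ψ⁻(u) = ∑ ψ⁻_{-n} u^{-n}`;
here `Ψ⁻` is given as a power series in `u⁻¹`. -/
def loopWeightSpace (ρ : UqAff q →ₐ[ℂ] Module.End ℂ V) (Ψp Ψm : PowerSeries ℂ) :
    Submodule ℂ V where
  carrier := {v | ∃ p : ℕ, ∀ n : ℕ,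
    ((ρ (phiPlus q n) - algebraMap ℂ _ (PowerSeries.coeff n Ψp)) ^ p) v = 0 ∧
    ((ρ (phiMinus q (-n)) - algebraMap ℂ _ (PowerSeries.coeff n Ψm)) ^ p) v = 0}
  zero_mem' := ⟨0, fun n => by simp⟩
  add_mem' := by
    rintro v w ⟨p, hp⟩ ⟨s, hs⟩
    refine ⟨p + s, fun n => ⟨?_, ?_⟩⟩
    · rw [map_add]
      nth_rewrite 1 [add_comm p s]
      rw [pow_add, pow_add, Module.End.mul_apply, Module.End.mul_apply, (hp n).1, (hs n).1]
      simp
    · rw [map_add]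
      nth_rewrite 1 [add_comm p s]
      rw [pow_add, pow_add, Module.End.mul_apply, Module.End.mul_apply, (hp n).2, (hs n).2]
      simp
  smul_mem' := by
    rintro c v ⟨p, hp⟩
    refine ⟨p, fun n => ⟨?_, ?_⟩⟩
    · rw [map_smul, (hp n).1, smul_zero]
    · rw [map_smul, (hp n).2, smul_zero]

/-- Expansion of the rational function `N / D` about `u = 0` (for `D(0) ≠ 0`). -/
def expandZero (N D : ℂ[X]) : PowerSeries ℂ := (N : PowerSeries ℂ) * (D : PowerSeries ℂ)⁻¹

/-- Expansion of the rational function `N / D` about `u = ∞`, as a power series in `w = u⁻¹` (for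
`D ≠ 0` and `deg N ≤ deg D`): with `d = deg D`, this is `w^d N(w⁻¹) / (w^d D(w⁻¹))`. -/
def expandInfty (N D : ℂ[X]) : PowerSeries ℂ :=
  (N.reflect D.natDegree : PowerSeries ℂ) * (D.reflect D.natDegree : PowerSeries ℂ)⁻¹

/-- The polynomial `P(q⁻² u)`. -/
def qShift (q : ℂˣ) (P : ℂ[X]) : ℂ[X] := P.comp (C ((q : ℂ) ^ (-2 : ℤ)) * X)

/-- `Ψ⁺` for the pair `(Q, R)`: the expansion about `0` of
`q^{deg Q - deg R} Q(q⁻² u) R(u) / (Q(u) R(q⁻² u))`. -/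
def psiPlus (q : ℂˣ) (Q R : ℂ[X]) : PowerSeries ℂ :=
  ((q : ℂ) ^ ((Q.natDegree : ℤ) - R.natDegree)) •
    expandZero (qShift q Q * R) (Q * qShift q R)

/-- `Ψ⁻` for the pair `(Q, R)`: the expansion about `∞` of the same rational function. -/
def psiMinus (q : ℂˣ) (Q R : ℂ[X]) : PowerSeries ℂ :=
  ((q : ℂ) ^ ((Q.natDegree : ℤ) - R.natDegree)) •
    expandInfty (qShift q Q * R) (Q * qShift q R)

/-- The space `V_{Q R⁻¹}`, for polynomials `Q`, `R` with constant term `1`. -/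
def loopWeightSpaceOf (ρ : UqAff q →ₐ[ℂ] Module.End ℂ V) (Q R : ℂ[X]) : Submodule ℂ V :=
  loopWeightSpace ρ (psiPlus q Q R) (psiMinus q Q R)

/-- Highest weight vectors: `v ≠ 0` generates `V`, is annihilated by all `X⁺_n`, and is a
simultaneous eigenvector for `K` and all `H_n`, `n ≠ 0`. -/
structure IsHighestWeightVector (ρ : UqAff q →ₐ[ℂ] Module.End ℂ V) (v : V) : Prop where
  ne_zero : v ≠ 0
  generates : ∀ w : V, ∃ x : UqAff q, ρ x v = w
  Xp : ∀ n : ℤ, ρ (loopGen q (.Xp n)) v = 0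
  K : ∃ c : ℂ, ρ (loopGen q .K) v = c • v
  H : ∀ (n : ℤ) (hn : n ≠ 0), ∃ c : ℂ, ρ (loopGen q (.H n hn)) v = c • v

/-- `P` is the Drinfeld polynomial of the irreducible type `1` representation `ρ`: it has constant
term `1`, and on a highest weight vector the eigenvalues of `Φ⁺_n` and `Φ⁻_{-n}`, `n ≥ 0`, are the
coefficients of the expansions of `q^{deg P} P(q⁻² u) / P(u)` about `0` and `∞`. -/
structure IsDrinfeldPolynomial (ρ : UqAff q →ₐ[ℂ] Module.End ℂ V) (P : ℂ[X]) : Prop where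
  typeOne : IsTypeOne ρ
  irreducible : IsIrreducibleRep ρ
  coeff_zero : P.coeff 0 = 1
  exists_highest : ∃ v : V, IsHighestWeightVector ρ v ∧ ∀ n : ℕ,
    ρ (phiPlus q n) v = PowerSeries.coeff n
      ((q : ℂ) ^ P.natDegree • expandZero (qShift q P) P) • v ∧
    ρ (phiMinus q (-n)) v = PowerSeries.coeff n
      ((q : ℂ) ^ P.natDegree • expandInfty (qShift q P) P) • v

end Rep

/-- `Q_{k,a} = ∏_{m=k+1}^r (1 - q^{r-2m+1} a u)`. -/
def polyQ (q a : ℂˣ) (r k : ℕ) : ℂ[X] :=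
  ∏ m ∈ Finset.Icc (k + 1) r, (1 - C ((q : ℂ) ^ ((r : ℤ) - 2 * m + 1) * (a : ℂ)) * X)

/-- `R_{k,a} = ∏_{m=1}^k (1 - q^{r-2m+3} a u)`. -/
def polyR (q a : ℂˣ) (r k : ℕ) : ℂ[X] :=
  ∏ m ∈ Finset.Icc 1 k, (1 - C ((q : ℂ) ^ ((r : ℤ) - 2 * m + 3) * (a : ℂ)) * X)

end QAff

end

noncomputable section

namespace QAff

/-! ### Exponentials of formal power series -/

section Exp

variable {A : Type*} [Ring A]

/-! The representation can be written down explicitly. Attach the point `c_k = q^{r-2k+1} a`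
(`evPt`) to the arrow between `v_{k-1}` and `v_k`; consecutive points differ by the factor `q⁻²`.
Let `X^±_n` act as `x^±` times the `n`-th power of the point of the arrow, and let `H_n` act
diagonally, with eigenvalue on `v_k` equal to `(c_k^n + c_{k+1}^n - c_0^n - c_{r+1}^n) / (n (q -
q⁻¹))`.

The exponential in the definition of `Φ⁺` then sums on `v_k` to `q^{r-2k} (1 - c_0 u)(1 - c_{r+1} u)
/ ((1 - c_k u)(1 - c_{k+1} u))`. Its partial fraction expansion has poles only at the inverses of
`c_k` and `c_{k+1}`, with coefficients given by the products of `q`-numbers in `x⁺x⁻` and `x⁻x⁺`.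
This is the relation for `[X⁺_n, X⁻_m]` (`phiPlusEig_eq`, `phiMinusEig_eq`, `lift_phi_sub`), the
only hard one in `eval_rel`.

The representation is unique because `C^{1/2}` and the Chevalley generators determine every
homomorphism (`algHom_ext_chevalley`): they give `X^±_0`, `X⁺_{-1}` and `X⁻_1`, whose commutators
give `H_{±1}`; brackets with `H_{±1}` give all `X^±_n`, and commutators of these give all `H_n`.

For the loop-weights, the substitution `u ↦ q⁻²u` moves each `c_k` to `c_{k+1}`, so the quotient
built from `Q_{k,a}` and `R_{k,a}` telescopes to the function above (`qShift_polyQ_mul_polyR_mul`).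
All `Φ^±_n` are diagonal, and the constant terms `q^{r-2k}` already separate the `v_k`, so the
loop-weight spaces are the lines `ℂ v_k`. A loop-weight determines `Q / R`, because a power series
invariant under `u ↦ q⁻²u` is constant (`eq_of_qShift_mul_eq`). Irreducibility uses only `X^±_0`; a
highest weight vector lies in the kernel of `X⁺_0`, which is `ℂ v_0`, and there `R_{0,a} = 1`, so
the Drinfeld polynomial is `Q_{0,a}`. -/

theorem coeff_pow_of_lt {x : PowerSeries A} (hx : PowerSeries.coeff 0 x = 0) :
    ∀ {m n : ℕ}, n < m → PowerSeries.coeff n (x ^ m) = 0 := by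
  intro m
  induction m with
  | zero => intro n hn; omega
  | succ m ih =>
    intro n hn
    rw [pow_succ', PowerSeries.coeff_mul]
    refine Finset.sum_eq_zero fun p hp => ?_
    rw [Finset.HasAntidiagonal.mem_antidiagonal] at hp
    rcases Nat.eq_zero_or_pos p.1 with h | h
    · rw [h, hx, zero_mul]
    · rw [ih (by omega), mul_zero]

/-- Powers of series without constant term depend on lower coefficients only. -/
theorem coeff_pow_congr {x y : PowerSeries A} (hx : PowerSeries.coeff 0 x = 0)
    (hy : PowerSeries.coeff 0 y = 0) {n : ℕ}
    (h : ∀ s < n, PowerSeries.coeff s x = PowerSeries.coeff s y) (m : ℕ) :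
    (∀ i < n, PowerSeries.coeff i (x ^ m) = PowerSeries.coeff i (y ^ m)) ∧
    PowerSeries.coeff n (x ^ (m + 2)) = PowerSeries.coeff n (y ^ (m + 2)) := by
  have h1 : ∀ m, ∀ i < n, PowerSeries.coeff i (x ^ m) = PowerSeries.coeff i (y ^ m) := by
    intro m
    induction m with
    | zero => intro i _; simp
    | succ m ih =>
      intro i hi
      rw [pow_succ', pow_succ', PowerSeries.coeff_mul, PowerSeries.coeff_mul]
      refine Finset.sum_congr rfl fun p hp => ?_
      rw [Finset.HasAntidiagonal.mem_antidiagonal] at hp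
      rw [h _ (by omega), ih _ (by omega)]
  refine ⟨h1 m, ?_⟩
  rw [pow_succ' x, pow_succ' y, PowerSeries.coeff_mul, PowerSeries.coeff_mul]
  refine Finset.sum_congr rfl fun p hp => ?_
  rw [Finset.HasAntidiagonal.mem_antidiagonal] at hp
  rcases Nat.eq_zero_or_pos p.1 with h0 | h0
  · rw [h0, hx, hy, zero_mul, zero_mul]
  rcases Nat.eq_zero_or_pos p.2 with h0' | h0'
  · rw [h0', coeff_pow_of_lt hx (by omega), coeff_pow_of_lt hy (by omega), mul_zero, mul_zero]
  · rw [h _ (by omega), h1 _ _ (by omega)]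

variable [Algebra ℂ A]

/-- The coefficients of `exp x` may be computed from any long enough partial sum. -/
theorem expCoeff_eq_sum {x : PowerSeries A} (hx : PowerSeries.coeff 0 x = 0) {n N : ℕ}
    (h : n ≤ N) : expCoeff x n =
      ∑ m ∈ Finset.range (N + 1), (m.factorial : ℂ)⁻¹ • PowerSeries.coeff n (x ^ m) := by
  refine Finset.sum_subset (Finset.range_mono (by omega)) fun m _ hm => ?_
  rw [Finset.mem_range, not_lt] at hm
  rw [coeff_pow_of_lt hx (by omega), smul_zero]

theorem expCoeff_zero (x : PowerSeries A) : expCoeff x 0 = 1 := by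
  simp [expCoeff]

theorem expCoeff_eq_add {x : PowerSeries A} {n : ℕ} (hn : n ≠ 0) :
    expCoeff x n = PowerSeries.coeff n x + ∑ m ∈ Finset.range (n - 1),
      ((m + 2).factorial : ℂ)⁻¹ • PowerSeries.coeff n (x ^ (m + 2)) := by
  obtain ⟨n, rfl⟩ := Nat.exists_eq_succ_of_ne_zero hn
  rw [expCoeff, Finset.sum_range_succ', Finset.sum_range_succ']
  simp [PowerSeries.coeff_one, add_comm _ (PowerSeries.coeff (n + 1) x)]

/-- Equal coefficients of the exponentials give equal coefficients of the exponents. -/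
theorem coeff_eq_of_expCoeff_eq {x y : PowerSeries A} (hx : PowerSeries.coeff 0 x = 0)
    (hy : PowerSeries.coeff 0 y = 0) {n : ℕ} (hn : n ≠ 0)
    (h : ∀ s < n, PowerSeries.coeff s x = PowerSeries.coeff s y)
    (he : expCoeff x n = expCoeff y n) : PowerSeries.coeff n x = PowerSeries.coeff n y := by
  rw [expCoeff_eq_add hn, expCoeff_eq_add hn] at he
  rw [Finset.sum_congr rfl fun m _ => by rw [(coeff_pow_congr hx hy h m).2]] at he
  exact add_right_cancel he

theorem map_expCoeff {B : Type*} [Ring B] [Algebra ℂ B] (f : A →ₐ[ℂ] B) (x : PowerSeries A)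
    (n : ℕ) : f (expCoeff x n) = expCoeff (PowerSeries.map (f : A →+* B) x) n := by
  simp only [expCoeff, map_sum, map_smul, ← map_pow, PowerSeries.coeff_map]
  rfl

/-- Simultaneous eigenvectors of the coefficients of `x` are eigenvectors of those of `exp x`. -/
theorem expCoeff_apply_eigenvector {V : Type*} [AddCommGroup V] [Module ℂ V]
    (x : PowerSeries (Module.End ℂ V)) (c : PowerSeries ℂ) (v : V)
    (h : ∀ n, PowerSeries.coeff n x v = PowerSeries.coeff n c • v) (n : ℕ) :
    expCoeff x n v = expCoeff c n • v := by
  have key : ∀ m n, (PowerSeries.coeff n (x ^ m) : Module.End ℂ V) v = PowerSeries.coeff n (c ^ m) • v := by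
    intro m
    induction m with
    | zero =>
      intro n
      rw [pow_zero, pow_zero, PowerSeries.coeff_one, PowerSeries.coeff_one]
      split_ifs <;> simp
    | succ m ih =>
      intro n
      -- The last operator factor acts first on `v`, so the operator power is split on the right and
      -- the scalar power on the left; swapping the antidiagonal matches the two sums.
      rw [pow_succ, pow_succ', PowerSeries.coeff_mul, PowerSeries.coeff_mul, LinearMap.sum_apply,
        Finset.sum_smul, ← Finset.sum_equiv (Equiv.prodComm ℕ ℕ) (s := Finset.HasAntidiagonal.antidiagonal n)
          (g := fun p => (PowerSeries.coeff p.1 c * PowerSeries.coeff p.2 (c ^ m)) • v)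
          (f := fun p => (PowerSeries.coeff p.2 c * PowerSeries.coeff p.1 (c ^ m)) • v)
          (by simp [add_comm]) (by simp)]
      refine Finset.sum_congr rfl fun p _ => ?_
      rw [Module.End.mul_apply, h, map_smul, ih, smul_smul]
  simp only [expCoeff, LinearMap.sum_apply, LinearMap.smul_apply, key, Finset.sum_smul, smul_assoc]

end Exp

/-- The exponential of a power series without constant term solves `Y' = x' Y`. -/
theorem derivative_mk_expCoeff {x : PowerSeries ℂ} (hx : PowerSeries.coeff 0 x = 0) :
    PowerSeries.derivative ℂ (PowerSeries.mk (expCoeff x)) =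
      PowerSeries.derivative ℂ x * PowerSeries.mk (expCoeff x) := by
  -- Finite partial sums avoid infinite sums: differentiation lowers the length by one, and each
  -- coefficient is already exact in a long enough partial sum.
  set S : ℕ → PowerSeries ℂ := fun N => ∑ m ∈ Finset.range (N + 1), (m.factorial : ℂ)⁻¹ • x ^ m
  have hS : ∀ n N, n ≤ N → PowerSeries.coeff n (S N) = expCoeff x n := by
    intro n N h
    rw [expCoeff_eq_sum hx h]
    simp [S]
  have hd : ∀ N, PowerSeries.derivative ℂ (S (N + 1)) = PowerSeries.derivative ℂ x * S N := by
    intro N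
    simp only [S]
    rw [Finset.sum_range_succ', map_add, map_sum, Finset.mul_sum]
    simp only [pow_zero, Derivation.map_smul, PowerSeries.derivative_one, smul_zero, add_zero]
    refine Finset.sum_congr rfl fun m _ => ?_
    rw [Derivation.leibniz_pow, Nat.add_sub_cancel, ← Nat.cast_smul_eq_nsmul ℂ, smul_smul,
      mul_smul_comm, smul_eq_mul, mul_comm (x ^ m)]
    congr 1
    rw [Nat.factorial_succ]
    have h1 : (m.factorial : ℂ) ≠ 0 := by exact_mod_cast m.factorial_ne_zero
    have h2 : ((m + 1 : ℕ) : ℂ) ≠ 0 := by exact_mod_cast m.succ_ne_zero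
    push_cast at h2 ⊢
    field_simp
  ext n
  rw [PowerSeries.coeff_derivative, PowerSeries.coeff_mk, ← hS (n + 1) (n + 1) le_rfl,
    ← PowerSeries.coeff_derivative, hd, PowerSeries.coeff_mul, PowerSeries.coeff_mul]
  refine Finset.sum_congr rfl fun p hp => ?_
  rw [Finset.HasAntidiagonal.mem_antidiagonal] at hp
  rw [hS _ _ (by omega), PowerSeries.coeff_mk]

/-- Uniqueness for the differential equation `Y' = g Y`. -/
theorem eq_of_derivative_eq_mul {g Y Z : PowerSeries ℂ}
    (hY : PowerSeries.derivative ℂ Y = g * Y) (hZ : PowerSeries.derivative ℂ Z = g * Z)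
    (h0 : PowerSeries.coeff 0 Y = PowerSeries.coeff 0 Z) : Y = Z := by
  ext n
  induction n using Nat.strong_induction_on with
  | _ n ih =>
    rcases n with _ | n
    · exact h0
    · have h1 := congrArg (PowerSeries.coeff n) hY
      have h2 := congrArg (PowerSeries.coeff n) hZ
      rw [PowerSeries.coeff_derivative, PowerSeries.coeff_mul] at h1 h2
      have h3 : (n : ℂ) + 1 ≠ 0 := Nat.cast_add_one_ne_zero n
      apply mul_right_cancel₀ h3
      rw [h1, h2]
      refine Finset.sum_congr rfl fun p hp => ?_
      rw [Finset.HasAntidiagonal.mem_antidiagonal] at hp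
      rw [ih _ (by omega)]

/-! ### Linear factors and geometric series -/

/-- The linear power series `1 - c u`. -/
def linFactor (c : ℂ) : PowerSeries ℂ := 1 - PowerSeries.C c * PowerSeries.X

/-- The geometric series `∑ c^n u^n`. -/
def geomSeries (c : ℂ) : PowerSeries ℂ := PowerSeries.mk fun n => c ^ n

theorem linFactor_mul_geomSeries (c : ℂ) : linFactor c * geomSeries c = 1 := by
  ext n
  rw [linFactor, sub_mul, one_mul, mul_assoc, map_sub, PowerSeries.coeff_C_mul]
  rcases n with _ | n
  · simp [geomSeries, PowerSeries.coeff_zero_X_mul]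
  · rw [PowerSeries.coeff_succ_X_mul]
    simp [geomSeries, PowerSeries.coeff_one, pow_succ']

theorem coeff_zero_linFactor (c : ℂ) : PowerSeries.coeff 0 (linFactor c) = 1 := by
  simp [linFactor]

theorem linFactor_ne_zero (c : ℂ) : linFactor c ≠ 0 := fun h => by
  simpa [h] using linFactor_mul_geomSeries c

/-- The logarithmic derivative of `1 - cu`, put in the form `Y' = gY` needed by the uniqueness
lemma. -/
theorem derivative_linFactor (c : ℂ) : PowerSeries.derivative ℂ (linFactor c) =
    -(PowerSeries.C c * geomSeries c) * linFactor c := by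
  have h := linFactor_mul_geomSeries c
  have : PowerSeries.derivative ℂ (linFactor c) = -PowerSeries.C c := by
    simp [linFactor]
  rw [this]
  linear_combination PowerSeries.C c * h

/-- The logarithm of `(1 - d₁ u)(1 - d₂ u) / ((1 - c₁ u)(1 - c₂ u))`. -/
def logQuot (c₁ c₂ d₁ d₂ : ℂ) : PowerSeries ℂ :=
  PowerSeries.mk fun n => (c₁ ^ n + c₂ ^ n - d₁ ^ n - d₂ ^ n) / (n : ℂ)

theorem derivative_logQuot (c₁ c₂ d₁ d₂ : ℂ) :
    PowerSeries.derivative ℂ (logQuot c₁ c₂ d₁ d₂) =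
      PowerSeries.C c₁ * geomSeries c₁ + PowerSeries.C c₂ * geomSeries c₂
        - PowerSeries.C d₁ * geomSeries d₁ - PowerSeries.C d₂ * geomSeries d₂ := by
  ext n
  rw [PowerSeries.coeff_derivative]
  simp only [map_add, map_sub, PowerSeries.coeff_C_mul, geomSeries, logQuot, PowerSeries.coeff_mk,
    Nat.cast_add, Nat.cast_one]
  rw [div_mul_cancel₀ _ (Nat.cast_add_one_ne_zero n)]
  ring

/-- Both sides have constant term `1` and the same logarithmic derivative: the contributions of `c₁`
and `c₂` to the exponential cancel against those of the linear factors. -/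
theorem mk_expCoeff_logQuot_mul (c₁ c₂ d₁ d₂ : ℂ) :
    PowerSeries.mk (expCoeff (logQuot c₁ c₂ d₁ d₂)) * (linFactor c₁ * linFactor c₂) =
      linFactor d₁ * linFactor d₂ := by
  have h0 : PowerSeries.coeff 0 (logQuot c₁ c₂ d₁ d₂) = 0 := by simp [logQuot]
  apply eq_of_derivative_eq_mul
    (g := -(PowerSeries.C d₁ * geomSeries d₁ + PowerSeries.C d₂ * geomSeries d₂))
  · simp only [Derivation.leibniz, derivative_mk_expCoeff h0, derivative_logQuot,
      derivative_linFactor, smul_eq_mul]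
    ring
  · simp only [Derivation.leibniz, derivative_linFactor, smul_eq_mul]
    ring
  · simp only [PowerSeries.coeff_mul, Finset.HasAntidiagonal.antidiagonal_zero, Finset.sum_singleton,
      coeff_zero_linFactor, PowerSeries.coeff_mk, expCoeff_zero, mul_one]

/-- Partial fractions for `(1 - d₁ u)(1 - d₂ u) / ((1 - c₁ u)(1 - c₂ u))`. -/
theorem expCoeff_logQuot {c₁ c₂ d₁ d₂ α β γ : ℂ} (h0 : γ + α + β = 1)
    (h1 : γ * (c₁ + c₂) + α * c₂ + β * c₁ = d₁ + d₂) (h2 : γ * (c₁ * c₂) = d₁ * d₂) (n : ℕ) :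
    expCoeff (logQuot c₁ c₂ d₁ d₂) n = (if n = 0 then γ else 0) + α * c₁ ^ n + β * c₂ ^ n := by
  have key : PowerSeries.mk (expCoeff (logQuot c₁ c₂ d₁ d₂)) =
      PowerSeries.C γ + PowerSeries.C α * geomSeries c₁ + PowerSeries.C β * geomSeries c₂ := by
    apply mul_right_cancel₀ (mul_ne_zero (linFactor_ne_zero c₁) (linFactor_ne_zero c₂))
    rw [mk_expCoeff_logQuot_mul]
    have e1 := linFactor_mul_geomSeries c₁
    have e2 := linFactor_mul_geomSeries c₂
    have f0 := congrArg (PowerSeries.C (R := ℂ)) h0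
    have f1 := congrArg (PowerSeries.C (R := ℂ)) h1
    have f2 := congrArg (PowerSeries.C (R := ℂ)) h2
    simp only [map_add, map_mul, map_one] at f0 f1 f2
    have : (PowerSeries.C γ + PowerSeries.C α * geomSeries c₁ + PowerSeries.C β * geomSeries c₂) *
        (linFactor c₁ * linFactor c₂) = PowerSeries.C γ * (linFactor c₁ * linFactor c₂) +
          PowerSeries.C α * linFactor c₂ + PowerSeries.C β * linFactor c₁ := by
      linear_combination PowerSeries.C α * linFactor c₂ * e1 + PowerSeries.C β * linFactor c₁ * e2
    rw [this]
    simp only [linFactor]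
    -- After clearing denominators, the three hypotheses are the comparisons of the coefficients of
    -- `1`, `u` and `u²`.
    linear_combination -f0 + PowerSeries.X * f1 - PowerSeries.X ^ 2 * f2
  have := congrArg (PowerSeries.coeff n) key
  simpa [geomSeries, PowerSeries.coeff_C] using this

/-! ### The evaluation representation in terms of the loop generators -/

section Evaluation

/-- The evaluation point `q^{r-2k+1} a` attached to the pair `v_{k-1}, v_k`. -/
def evPt (q a : ℂˣ) (r : ℕ) (k : ℤ) : ℂ := (q : ℂ) ^ ((r : ℤ) - 2 * k + 1) * (a : ℂ)

theorem evPt_ne_zero (q a : ℂˣ) (r : ℕ) (k : ℤ) : evPt q a r k ≠ 0 :=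
  mul_ne_zero (zpow_ne_zero _ q.ne_zero) a.ne_zero

theorem evPt_succ (q a : ℂˣ) (r : ℕ) (k : ℤ) :
    evPt q a r (k + 1) = (q : ℂ) ^ (-2 : ℤ) * evPt q a r k := by
  rw [evPt, evPt, ← mul_assoc, ← zpow_add₀ q.ne_zero]
  congr 2
  ring

theorem evPt_eq_sq_mul (q a : ℂˣ) (r : ℕ) (k : ℤ) :
    evPt q a r k = (q : ℂ) ^ (2 : ℤ) * evPt q a r (k + 1) := by
  rw [evPt_succ, ← mul_assoc, ← zpow_add₀ q.ne_zero]
  simp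

/-- `q - q⁻¹` does not vanish when `q` is not a root of unity. -/
theorem sub_inv_ne_zero {q : ℂˣ} (hq : ∀ n : ℕ, 0 < n → q ^ n ≠ 1) :
    (q : ℂ) - (q : ℂ)⁻¹ ≠ 0 := by
  intro h
  apply hq 2 two_pos
  ext
  have h0 : (q : ℂ) ≠ 0 := q.ne_zero
  field_simp at h
  push_cast
  linear_combination h

theorem zpow_ne_one {q : ℂˣ} (hq : ∀ n : ℕ, 0 < n → q ^ n ≠ 1) {n : ℤ} (hn : n ≠ 0) :
    (q : ℂ) ^ n ≠ 1 := by
  intro h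
  have h' : q ^ n = 1 := by
    ext
    push_cast
    exact h
  apply hq n.natAbs (Int.natAbs_pos.mpr hn)
  rcases Int.natAbs_eq n with e | e
  · rw [e, zpow_natCast] at h'
    exact h'
  · rw [e, zpow_neg, zpow_natCast, inv_eq_one] at h'
    exact h'

theorem zpow_left_injective {q : ℂˣ} (hq : ∀ n : ℕ, 0 < n → q ^ n ≠ 1) {m n : ℤ}
    (h : (q : ℂ) ^ m = (q : ℂ) ^ n) : m = n := by
  by_contra hne
  apply zpow_ne_one hq (sub_ne_zero.mpr hne)
  rw [zpow_sub₀ q.ne_zero, h, div_self (zpow_ne_zero _ q.ne_zero)]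

theorem qInt_ne_zero {q : ℂˣ} (hq : ∀ n : ℕ, 0 < n → q ^ n ≠ 1) {n : ℤ} (hn : n ≠ 0) :
    qInt q n ≠ 0 := by
  refine div_ne_zero (fun h => ?_) (sub_inv_ne_zero hq)
  have := zpow_left_injective hq (sub_eq_zero.mp h)
  omega

theorem qInt_zero (q : ℂˣ) : qInt q 0 = 0 := by simp [qInt]

/-- The eigenvalue of `H_n` on `v_k`. -/
def hEig (q a : ℂˣ) (r : ℕ) (n k : ℤ) : ℂ :=
  ((q : ℂ) - (q : ℂ)⁻¹)⁻¹ * ((evPt q a r k ^ n + evPt q a r (k + 1) ^ n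
    - evPt q a r 0 ^ n - evPt q a r (r + 1) ^ n) / (n : ℂ))

/-- Neighbouring eigenvalues share the term `c_{k+1}^n`; what remains is `c_k^n - c_{k+2}^n =
(q^{2n} - q^{-2n}) c_{k+1}^n`. This is the relation for `[H_n, X^±_m]`. -/
theorem hEig_sub (q a : ℂˣ) (r : ℕ) (n k : ℤ) :
    hEig q a r n k - hEig q a r n (k + 1) =
      1 / (n : ℂ) * qInt q (2 * n) * evPt q a r (k + 1) ^ n := by
  have h1 : evPt q a r k ^ n = (q : ℂ) ^ (2 * n) * evPt q a r (k + 1) ^ n := by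
    rw [evPt_eq_sq_mul q a r k, mul_zpow, zpow_mul]
  have h2 : evPt q a r (k + 1 + 1) ^ n = (q : ℂ) ^ (-(2 * n)) * evPt q a r (k + 1) ^ n := by
    rw [evPt_succ q a r (k + 1), mul_zpow, ← zpow_mul]
    congr 2
    ring
  rw [hEig, hEig, h1, h2, qInt]
  ring

/-- The action of the loop generators in the evaluation representation. -/
def evalGen (q a : ℂˣ) (r : ℕ) : LoopGen → Module.End ℂ (SpinSpace r)
  | .Chalf => 1
  | .ChalfInv => 1
  | .K => spinGen q r .K
  | .Kinv => spinGen q r .Kinv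
  | .H n _ => (Pi.basisFun ℂ (Fin (r + 1))).constr ℂ
      fun k => hEig q a r n (k : ℕ) • spinVec r k
  | .Xp n => (Pi.basisFun ℂ (Fin (r + 1))).constr ℂ
      fun k => evPt q a r (k : ℕ) ^ n • spinGen q r .xp (spinVec r k)
  | .Xm n => (Pi.basisFun ℂ (Fin (r + 1))).constr ℂ
      fun k => evPt q a r ((k : ℕ) + 1) ^ n • spinGen q r .xm (spinVec r k)

variable (q a : ℂˣ) (r : ℕ)

theorem evalGen_H (n : ℤ) (hn : n ≠ 0) (j : ℕ) :
    evalGen q a r (.H n hn) (spinVec r j) = hEig q a r n j • spinVec r j := by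
  by_cases h : j < r + 1
  · rw [spinVec_eq_basis h, evalGen, Module.Basis.constr_basis, ← spinVec_eq_basis h]
  · simp [spinVec_eq_zero h]

theorem evalGen_Xm (n : ℤ) (j : ℕ) : evalGen q a r (.Xm n) (spinVec r j) =
    (evPt q a r (j + 1) ^ n * qInt q (j + 1)) • spinVec r (j + 1) := by
  by_cases h : j < r + 1
  · rw [spinVec_eq_basis h, evalGen, Module.Basis.constr_basis, spinGen_xm, smul_smul]
  · have h' : ¬ j + 1 < r + 1 := by omega
    simp [spinVec_eq_zero h, spinVec_eq_zero h']

theorem evalGen_Xp (n : ℤ) (j : ℕ) : evalGen q a r (.Xp n) (spinVec r j) =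
    evPt q a r j ^ n • spinGen q r .xp (spinVec r j) := by
  by_cases h : j < r + 1
  · rw [spinVec_eq_basis h, evalGen, Module.Basis.constr_basis, ← spinVec_eq_basis h]
  · simp [spinVec_eq_zero h]

theorem evalGen_Xp_zero (n : ℤ) : evalGen q a r (.Xp n) (spinVec r 0) = 0 := by
  rw [evalGen_Xp, spinGen_xp_zero, smul_zero]

theorem evalGen_Xp_succ (n : ℤ) (j : ℕ) : evalGen q a r (.Xp n) (spinVec r (j + 1)) =
    (evPt q a r (j + 1) ^ n * qInt q (r - j)) • spinVec r j := by
  rw [evalGen_Xp, spinGen_xp_succ, smul_smul]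
  push_cast
  rfl

theorem lift_cHalfPow (n : ℤ) : FreeAlgebra.lift ℂ (evalGen q a r) (cHalfPow n) = 1 := by
  rw [cHalfPow]
  split_ifs <;> simp [loopFree, evalGen]

/-- The eigenvalue of `(q - q⁻¹) [X⁺_m, X⁻_{n-m}]` on `v_k`. -/
def commEig (n k : ℤ) : ℂ :=
  ((q : ℂ) - (q : ℂ)⁻¹) * (evPt q a r (k + 1) ^ n * (qInt q (k + 1) * qInt q (r - k))
    - evPt q a r k ^ n * (qInt q k * qInt q (r - k + 1)))

/-- The eigenvalue of `Φ⁺_n` on `v_k`, for `n ≥ 0`. -/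
def phiPlusEig (k n : ℕ) : ℂ :=
  (if n = 0 then (q : ℂ) ^ (-((r : ℤ) - 2 * k)) else 0) + commEig q a r n k

/-- The eigenvalue of `Φ⁻_{-n}` on `v_k`, for `n ≥ 0`. -/
def phiMinusEig (k n : ℕ) : ℂ :=
  (if n = 0 then (q : ℂ) ^ ((r : ℤ) - 2 * k) else 0) - commEig q a r (-n) k

/-- The logarithm of the series `Φ⁺(u)` on `v_k`, up to its constant factor. -/
def phiPlusLog (k : ℕ) : PowerSeries ℂ :=
  logQuot (evPt q a r (k + 1)) (evPt q a r k) (evPt q a r 0) (evPt q a r (r + 1))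

/-- The logarithm of the series `Φ⁻(u)` on `v_k`, up to its constant factor. -/
def phiMinusLog (k : ℕ) : PowerSeries ℂ :=
  logQuot (evPt q a r (k + 1))⁻¹ (evPt q a r k)⁻¹ (evPt q a r 0)⁻¹ (evPt q a r (r + 1))⁻¹

variable {q}

/-- A normal form: with every exponent reduced to `q^k` and `q^r`, the identities below become
rational identities in `q`, `a` and two further nonzero quantities. -/
theorem zpow_weight (k : ℕ) :
    (q : ℂ) ^ ((r : ℤ) - 2 * k) = (q : ℂ) ^ r * ((q : ℂ) ^ k)⁻¹ * ((q : ℂ) ^ k)⁻¹ := by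
  rw [show (r : ℤ) - 2 * k = r + -k + -k by ring, zpow_add₀ q.ne_zero, zpow_add₀ q.ne_zero,
    zpow_neg, zpow_natCast, zpow_natCast]

theorem evPt_natCast (k : ℕ) : evPt q a r k =
    (q : ℂ) ^ r * ((q : ℂ) ^ k)⁻¹ * ((q : ℂ) ^ k)⁻¹ * (q : ℂ) * (a : ℂ) := by
  rw [evPt, zpow_add_one₀ q.ne_zero, zpow_weight]

theorem evPt_natCast_succ (k : ℕ) : evPt q a r (k + 1) =
    (q : ℂ) ^ r * ((q : ℂ) ^ k)⁻¹ * ((q : ℂ) ^ k)⁻¹ * (q : ℂ)⁻¹ * (a : ℂ) := by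
  have h : (q : ℂ) ≠ 0 := q.ne_zero
  rw [evPt_succ, evPt_natCast, zpow_neg, zpow_ofNat]
  field_simp

theorem qInt_natCast_mul (k : ℕ) : qInt q k * qInt q (r - k + 1) =
    ((q : ℂ) ^ k - ((q : ℂ) ^ k)⁻¹) *
      ((q : ℂ) ^ r * ((q : ℂ) ^ k)⁻¹ * (q : ℂ) - ((q : ℂ) ^ r)⁻¹ * (q : ℂ) ^ k * (q : ℂ)⁻¹) /
      (((q : ℂ) - (q : ℂ)⁻¹) * ((q : ℂ) - (q : ℂ)⁻¹)) := by
  have h : (q : ℂ) ≠ 0 := q.ne_zero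
  rw [qInt, qInt, div_mul_div_comm, zpow_neg, zpow_neg, zpow_add_one₀ h, zpow_sub₀ h,
    zpow_natCast, zpow_natCast]
  simp only [div_eq_mul_inv, mul_inv, inv_inv]

theorem qInt_natCast_succ_mul (k : ℕ) : qInt q (k + 1) * qInt q (r - k) =
    ((q : ℂ) ^ k * (q : ℂ) - ((q : ℂ) ^ k)⁻¹ * (q : ℂ)⁻¹) *
      ((q : ℂ) ^ r * ((q : ℂ) ^ k)⁻¹ - ((q : ℂ) ^ r)⁻¹ * (q : ℂ) ^ k) /
      (((q : ℂ) - (q : ℂ)⁻¹) * ((q : ℂ) - (q : ℂ)⁻¹)) := by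
  have h : (q : ℂ) ≠ 0 := q.ne_zero
  rw [qInt, qInt, div_mul_div_comm, zpow_neg, zpow_neg, zpow_add_one₀ h, zpow_sub₀ h,
    zpow_natCast, zpow_natCast]
  simp only [div_eq_mul_inv, mul_inv, inv_inv]

/-- The computational heart: the series defined by the exponential agrees with the one dictated by
`[X⁺, X⁻]`, by partial fractions. -/
theorem phiPlusEig_eq (hq : ∀ n : ℕ, 0 < n → q ^ n ≠ 1) (k n : ℕ) :
    phiPlusEig q a r k n = (q : ℂ) ^ ((r : ℤ) - 2 * k) * expCoeff (phiPlusLog q a r k) n := by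
  have h : (q : ℂ) ≠ 0 := q.ne_zero
  have ha : (a : ℂ) ≠ 0 := a.ne_zero
  have hk := zpow_ne_zero ((r : ℤ) - 2 * k) h
  have hd := sub_inv_ne_zero hq
  have e0 := evPt_natCast (q := q) a r 0
  have er := evPt_natCast_succ (q := q) a r r
  rw [Nat.cast_zero] at e0
  have hx : (q : ℂ) ^ k ≠ 0 := pow_ne_zero _ h
  have hy : (q : ℂ) ^ r ≠ 0 := pow_ne_zero _ h
  have hd2 : (q : ℂ) ^ 2 - 1 ≠ 0 := fun h2 => hd (by field_simp; linear_combination h2)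
  -- `γ` is the value `c_0 c_{r+1} / (c_k c_{k+1}) = q^{-2(r-2k)}` of the quotient at infinity. The
  -- numbers `α` and `β` are the two parts of `commEig`, divided by the `K`-eigenvalue.
  rw [phiPlusLog, expCoeff_logQuot
    (γ := ((q : ℂ) ^ ((r : ℤ) - 2 * k))⁻¹ * ((q : ℂ) ^ ((r : ℤ) - 2 * k))⁻¹)
    (α := ((q : ℂ) ^ ((r : ℤ) - 2 * k))⁻¹ *
      (((q : ℂ) - (q : ℂ)⁻¹) * (qInt q (k + 1) * qInt q (r - k))))
    (β := -(((q : ℂ) ^ ((r : ℤ) - 2 * k))⁻¹ *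
      (((q : ℂ) - (q : ℂ)⁻¹) * (qInt q k * qInt q (r - k + 1)))))]
  · rw [phiPlusEig, commEig, zpow_neg, zpow_natCast, zpow_natCast]
    split_ifs <;> field_simp <;> ring
  · rw [qInt_natCast_mul, qInt_natCast_succ_mul, zpow_weight]
    generalize (q : ℂ) ^ k = x at *
    generalize (q : ℂ) ^ r = y at *
    field_simp
    ring
  · rw [qInt_natCast_mul, qInt_natCast_succ_mul, zpow_weight, e0, er, evPt_natCast,
      evPt_natCast_succ, pow_zero]
    generalize (q : ℂ) ^ k = x at *
    generalize (q : ℂ) ^ r = y at *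
    field_simp
    ring
  · rw [zpow_weight, e0, er, evPt_natCast, evPt_natCast_succ, pow_zero]
    generalize (q : ℂ) ^ k = x at *
    generalize (q : ℂ) ^ r = y at *
    field_simp

/-- The same expansion in `u⁻¹`: all points are inverted, and `α`, `β` change sign because `Φ⁻`
enters the commutator with a minus sign. -/
theorem phiMinusEig_eq (hq : ∀ n : ℕ, 0 < n → q ^ n ≠ 1) (k n : ℕ) :
    phiMinusEig q a r k n =
      (q : ℂ) ^ (-((r : ℤ) - 2 * k)) * expCoeff (phiMinusLog q a r k) n := by
  have h : (q : ℂ) ≠ 0 := q.ne_zero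
  have ha : (a : ℂ) ≠ 0 := a.ne_zero
  have hk := zpow_ne_zero ((r : ℤ) - 2 * k) h
  have hd := sub_inv_ne_zero hq
  have e0 := evPt_natCast (q := q) a r 0
  have er := evPt_natCast_succ (q := q) a r r
  rw [Nat.cast_zero] at e0
  have hx : (q : ℂ) ^ k ≠ 0 := pow_ne_zero _ h
  have hy : (q : ℂ) ^ r ≠ 0 := pow_ne_zero _ h
  have hd2 : (q : ℂ) ^ 2 - 1 ≠ 0 := fun h2 => hd (by field_simp; linear_combination h2)
  rw [phiMinusLog, zpow_neg, expCoeff_logQuot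
    (γ := (q : ℂ) ^ ((r : ℤ) - 2 * k) * (q : ℂ) ^ ((r : ℤ) - 2 * k))
    (α := -((q : ℂ) ^ ((r : ℤ) - 2 * k) *
      (((q : ℂ) - (q : ℂ)⁻¹) * (qInt q (k + 1) * qInt q (r - k)))))
    (β := (q : ℂ) ^ ((r : ℤ) - 2 * k) *
      (((q : ℂ) - (q : ℂ)⁻¹) * (qInt q k * qInt q (r - k + 1))))]
  · rw [phiMinusEig, commEig, zpow_neg, zpow_natCast, zpow_neg, zpow_natCast, inv_pow, inv_pow]
    split_ifs <;> field_simp <;> ring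
  · rw [qInt_natCast_mul, qInt_natCast_succ_mul, zpow_weight]
    generalize (q : ℂ) ^ k = x at *
    generalize (q : ℂ) ^ r = y at *
    field_simp
    ring
  · rw [qInt_natCast_mul, qInt_natCast_succ_mul, zpow_weight, e0, er, evPt_natCast,
      evPt_natCast_succ, pow_zero]
    generalize (q : ℂ) ^ k = x at *
    generalize (q : ℂ) ^ r = y at *
    field_simp
    ring
  · rw [zpow_weight, e0, er, evPt_natCast, evPt_natCast_succ, pow_zero]
    generalize (q : ℂ) ^ k = x at *
    generalize (q : ℂ) ^ r = y at *
    field_simp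

theorem lift_phiPlusFree (hq : ∀ n : ℕ, 0 < n → q ^ n ≠ 1) (k n : ℕ) :
    FreeAlgebra.lift ℂ (evalGen q a r) (phiPlusFree q n) (spinVec r k) =
      phiPlusEig q a r k n • spinVec r k := by
  rw [phiPlusFree, if_neg (by omega), map_mul, map_expCoeff, Module.End.mul_apply, Int.toNat_natCast,
    expCoeff_apply_eigenvector _ (phiPlusLog q a r k), phiPlusEig_eq a r hq, map_smul, loopFree,
    FreeAlgebra.lift_ι_apply, evalGen, spinGen_K, smul_smul, mul_comm]
  -- The factor `q - q⁻¹` in the exponent cancels the inverse built into `hEig`, leaving the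
  -- coefficients of `phiPlusLog`.
  intro s
  have hd := sub_inv_ne_zero hq
  simp only [PowerSeries.coeff_map, PowerSeries.coeff_smul, hSeriesPlus, PowerSeries.coeff_mk,
    phiPlusLog, logQuot]
  split_ifs with hs
  · simp [hs]
  · simp only [loopFree, RingHom.coe_coe, map_smul, FreeAlgebra.lift_ι_apply, LinearMap.smul_apply,
      evalGen_H, smul_smul, hEig, mul_inv_cancel_left₀ hd, zpow_natCast, Int.cast_natCast]
    congr 1
    ring

theorem lift_phiMinusFree (hq : ∀ n : ℕ, 0 < n → q ^ n ≠ 1) (k n : ℕ) :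
    FreeAlgebra.lift ℂ (evalGen q a r) (phiMinusFree q (-n)) (spinVec r k) =
      phiMinusEig q a r k n • spinVec r k := by
  rw [phiMinusFree, if_neg (by omega), map_mul, map_expCoeff, Module.End.mul_apply, neg_neg,
    Int.toNat_natCast,
    expCoeff_apply_eigenvector _ (phiMinusLog q a r k), phiMinusEig_eq a r hq, map_smul, loopFree,
    FreeAlgebra.lift_ι_apply, evalGen, spinGen_Kinv, smul_smul, mul_comm]
  intro s
  have hd := sub_inv_ne_zero hq
  simp only [PowerSeries.coeff_map, PowerSeries.coeff_smul, hSeriesMinus, PowerSeries.coeff_mk,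
    phiMinusLog, logQuot]
  split_ifs with hs
  · simp [hs]
  · simp only [loopFree, RingHom.coe_coe, map_smul, FreeAlgebra.lift_ι_apply, LinearMap.smul_apply,
      evalGen_H, smul_smul, hEig, neg_mul, mul_inv_cancel_left₀ hd, zpow_neg, zpow_natCast,
      Int.cast_neg, Int.cast_natCast, inv_pow]
    congr 1
    ring

/-- The constant term of `phiPlusEig_eq`; it amounts to `[k+1][r-k] - [k][r-k+1] = [r-2k]`. -/
theorem commEig_zero (hq : ∀ n : ℕ, 0 < n → q ^ n ≠ 1) (k : ℕ) :
    commEig q a r 0 k = (q : ℂ) ^ ((r : ℤ) - 2 * k) - (q : ℂ) ^ (-((r : ℤ) - 2 * k)) := by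
  have h1 := phiPlusEig_eq a r hq k 0
  rw [phiPlusEig, if_pos rfl, expCoeff_zero, Nat.cast_zero] at h1
  linear_combination h1

/-- One formula covers all `n`: only `Φ⁺` survives for `n > 0`, only `Φ⁻` for `n < 0`, and for `n =
0` the two extra constants are absorbed by `commEig_zero`. -/
theorem lift_phi_sub (hq : ∀ n : ℕ, 0 < n → q ^ n ≠ 1) (n : ℤ) (k : ℕ) :
    FreeAlgebra.lift ℂ (evalGen q a r) (phiPlusFree q n - phiMinusFree q n) (spinVec r k) =
      commEig q a r n k • spinVec r k := by
  rw [map_sub, LinearMap.sub_apply]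
  rcases lt_trichotomy n 0 with h | h | h
  · obtain ⟨m, rfl⟩ : ∃ m : ℕ, n = -m := ⟨n.natAbs, by omega⟩
    have hm : m ≠ 0 := by omega
    rw [lift_phiMinusFree a r hq, phiPlusFree, if_pos h, phiMinusEig, if_neg hm]
    simp
  · subst h
    have h1 := lift_phiPlusFree a r hq k 0
    have h2 := lift_phiMinusFree a r hq k 0
    rw [phiPlusEig, if_pos rfl] at h1
    rw [phiMinusEig, if_pos rfl] at h2
    rw [Nat.cast_zero] at h1 h2
    rw [neg_zero] at h2
    rw [h1, h2, ← sub_smul, commEig_zero a r hq]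
    congr 1
    ring
  · obtain ⟨m, rfl⟩ : ∃ m : ℕ, n = m := ⟨n.natAbs, by omega⟩
    have hm : m ≠ 0 := by omega
    rw [lift_phiPlusFree a r hq, phiMinusFree, if_pos h, phiPlusEig, if_neg hm]
    simp

end Evaluation

/-! ### Verification of the loop relations and of Jimbo's values -/

section EvaluationRelations

variable {q : ℂˣ} (a : ℂˣ) (r : ℕ)

/-- With `C^{1/2} = 1` the `H_n` must commute, and they do, being diagonal. The `H`–`X` relations
are `hEig_sub`, the `X`–`X` relations express that consecutive points have ratio `q^{±2}`, and the
`X⁺`–`X⁻` relation is `lift_phi_sub`. -/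
theorem eval_rel (hq : ∀ n : ℕ, 0 < n → q ^ n ≠ 1) ⦃x y : LoopFree⦄ (h : LoopRel q x y) :
    FreeAlgebra.lift ℂ (evalGen q a r) x = FreeAlgebra.lift ℂ (evalGen q a r) y := by
  have h0 : (q : ℂ) ≠ 0 := q.ne_zero
  cases h with
  | K_mul_Kinv =>
    simpa [loopFree, sl2Free, evalGen] using spin_rel q r Sl2Rel.K_mul_Kinv
  | Kinv_mul_K =>
    simpa [loopFree, sl2Free, evalGen] using spin_rel q r Sl2Rel.Kinv_mul_K
  | C_mul_Cinv => simp [loopFree, evalGen]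
  | C_central g =>
    simp only [loopFree, map_mul, FreeAlgebra.lift_ι_apply]
    simp only [evalGen, one_mul, mul_one]
  | Cinv_central g =>
    simp only [loopFree, map_mul, FreeAlgebra.lift_ι_apply]
    simp only [evalGen, one_mul, mul_one]
  | K_H n hn =>
    apply spin_ext; intro j hj
    simp only [loopFree, map_mul, FreeAlgebra.lift_ι_apply, Module.End.mul_apply, evalGen_H,
      map_smul]
    rw [show evalGen q a r .K = spinGen q r .K from rfl, spinGen_K, map_smul, evalGen_H,
      smul_smul, smul_smul, mul_comm]
  | H_H n m hn hm =>
    have : FreeAlgebra.lift ℂ (evalGen q a r) (if n = -m then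
        ((1 / (n : ℂ)) * qInt q (2 * n) * ((q : ℂ) - (q : ℂ)⁻¹)⁻¹) •
          (cHalfPow (2 * n) - cHalfPow (-(2 * n))) else 0) = 0 := by
      split_ifs
      · rw [map_smul, map_sub, lift_cHalfPow, lift_cHalfPow, sub_self, smul_zero]
      · rw [map_zero]
    rw [this]
    apply spin_ext; intro j hj
    simp only [loopFree, map_sub, map_mul, FreeAlgebra.lift_ι_apply, Module.End.mul_apply,
      LinearMap.sub_apply, evalGen_H, map_smul, smul_smul]
    rw [mul_comm, sub_self, LinearMap.zero_apply]
  | K_Xp n =>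
    apply spin_ext; intro j hj
    simp only [loopFree, map_mul, FreeAlgebra.lift_ι_apply, Module.End.mul_apply, map_smul,
      LinearMap.smul_apply]
    rcases j with _ | j
    · rw [show evalGen q a r .Kinv = spinGen q r .Kinv from rfl, spinGen_Kinv, map_smul,
        evalGen_Xp_zero, smul_zero, map_zero, smul_zero]
    · rw [evalGen_Xp_succ, evalGen, evalGen, spinGen_Kinv, map_smul, evalGen_Xp_succ, map_smul,
        map_smul, spinGen_K, smul_smul, smul_smul, smul_smul, mul_comm _ (_ * _), mul_assoc,
        ← zpow_add₀ h0, mul_comm]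
      congr 3
      push_cast; ring
  | K_Xm n =>
    apply spin_ext; intro j hj
    simp only [loopFree, map_mul, FreeAlgebra.lift_ι_apply, Module.End.mul_apply, map_smul,
      LinearMap.smul_apply]
    rw [evalGen_Xm, evalGen, evalGen, spinGen_Kinv, map_smul, evalGen_Xm, map_smul,
        map_smul, spinGen_K, smul_smul, smul_smul, smul_smul, mul_comm _ (_ * _), mul_assoc,
        ← zpow_add₀ h0, mul_comm]
    congr 3
    push_cast; ring
  | H_Xp n m hn =>
    apply spin_ext; intro j hj
    simp only [map_sub, map_mul, map_smul, lift_cHalfPow, one_mul]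
    simp only [loopFree, FreeAlgebra.lift_ι_apply, Module.End.mul_apply, map_smul,
      LinearMap.smul_apply, LinearMap.sub_apply, evalGen_H]
    rcases j with _ | j
    · simp [evalGen_Xp_zero]
    · simp only [evalGen_Xp_succ, map_smul, evalGen_H, smul_smul, ← sub_smul]
      congr 1
      rw [zpow_add₀ (evPt_ne_zero q a r _)]
      push_cast
      linear_combination evPt q a r (j + 1) ^ m * qInt q (r - j) * hEig_sub q a r n j
  | H_Xm n m hn =>
    apply spin_ext; intro j hj
    simp only [map_sub, map_mul, map_smul, lift_cHalfPow, one_mul]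
    simp only [loopFree, FreeAlgebra.lift_ι_apply, Module.End.mul_apply, map_smul,
      LinearMap.smul_apply, LinearMap.sub_apply, evalGen_H]
    simp only [evalGen_Xm, map_smul, evalGen_H, smul_smul, ← sub_smul]
    congr 1
    rw [zpow_add₀ (evPt_ne_zero q a r _)]
    push_cast
    linear_combination -evPt q a r (j + 1) ^ m * qInt q (j + 1) * hEig_sub q a r n j
  | Xp_Xp n m =>
    apply spin_ext; intro j hj
    simp only [loopFree, map_sub, map_smul, map_mul, FreeAlgebra.lift_ι_apply,
      Module.End.mul_apply, LinearMap.smul_apply, LinearMap.sub_apply]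
    rcases j with _ | _ | j
    · simp [evalGen_Xp_zero]
    · simp [evalGen_Xp_succ, evalGen_Xp_zero]
    · simp only [evalGen_Xp_succ, map_smul, smul_smul, ← sub_smul]
      congr 1
      push_cast
      rw [evPt_eq_sq_mul q a r (j + 1)]
      simp only [mul_zpow, zpow_add_one₀ (evPt_ne_zero q a r _),
        zpow_add_one₀ (zpow_ne_zero 2 h0)]
      ring
  | Xm_Xm n m =>
    apply spin_ext; intro j hj
    simp only [loopFree, map_sub, map_smul, map_mul, FreeAlgebra.lift_ι_apply,
      Module.End.mul_apply, LinearMap.smul_apply, LinearMap.sub_apply]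
    simp only [evalGen_Xm, map_smul, smul_smul, ← sub_smul]
    congr 1
    push_cast
    rw [evPt_succ q a r (j + 1)]
    simp only [mul_zpow, zpow_add_one₀ (evPt_ne_zero q a r _),
      zpow_add_one₀ (zpow_ne_zero (-2) h0)]
    ring
  | Xp_Xm n m =>
    apply spin_ext; intro j hj
    rw [map_smul (FreeAlgebra.lift ℂ (evalGen q a r)), map_sub, map_sub, map_mul _ (cHalfPow _),
      map_mul _ (cHalfPow _), lift_cHalfPow, lift_cHalfPow, one_mul, one_mul,
      ← map_sub _ (phiPlusFree _ _), LinearMap.smul_apply, lift_phi_sub a r hq, smul_smul, commEig,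
      inv_mul_cancel_left₀ (sub_inv_ne_zero hq), zpow_add₀ (evPt_ne_zero q a r _),
      zpow_add₀ (evPt_ne_zero q a r _)]
    simp only [loopFree, map_mul, FreeAlgebra.lift_ι_apply,
      Module.End.mul_apply, LinearMap.sub_apply]
    rcases j with _ | j
    · simp only [evalGen_Xm, evalGen_Xp_zero, map_smul, evalGen_Xp_succ, map_zero, sub_zero,
        smul_smul, Nat.cast_zero, qInt_zero]
      congr 1
      ring
    · simp only [evalGen_Xm, map_smul, evalGen_Xp_succ, smul_smul, ← sub_smul]
      congr 1
      push_cast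
      rw [show (r : ℤ) - (j + 1) + 1 = r - j by ring]
      ring

/-- The evaluation representation `V^{(r)}(a)`. -/
def evalRep (hq : ∀ n : ℕ, 0 < n → q ^ n ≠ 1) : UqAff q →ₐ[ℂ] Module.End ℂ (SpinSpace r) :=
  RingQuot.liftAlgHom ℂ ⟨FreeAlgebra.lift ℂ (evalGen q a r), eval_rel a r hq⟩

theorem evalRep_toUqAff (hq : ∀ n : ℕ, 0 < n → q ^ n ≠ 1) (x : LoopFree) :
    evalRep a r hq (toUqAff q x) = FreeAlgebra.lift ℂ (evalGen q a r) x :=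
  RingQuot.liftAlgHom_mkAlgHom_apply ..

theorem evalRep_loopGen (hq : ∀ n : ℕ, 0 < n → q ^ n ≠ 1) (g : LoopGen) :
    evalRep a r hq (loopGen q g) = evalGen q a r g := by
  rw [loopGen, evalRep_toUqAff, loopFree, FreeAlgebra.lift_ι_apply]

theorem spinRep_sl2Gen (g : Sl2Gen) : spinRep q r (sl2Gen q g) = spinGen q r g := by
  rw [sl2Gen, spinRep, RingQuot.liftAlgHom_mkAlgHom_apply, sl2Free, FreeAlgebra.lift_ι_apply]

/-- The dependence on `j` cancels for the two nontrivial generators: `c_{j+1} q^{-(r-2j)} = q⁻¹ a`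
for `X⁻_1 K⁻¹`, and `q^{r-2j} c_{j+1}⁻¹ = q a⁻¹` for `K X⁺_{-1}`. -/
theorem isEvaluationRep_evalRep (hq : ∀ n : ℕ, 0 < n → q ^ n ≠ 1) :
    IsEvaluationRep q a r (evalRep a r hq) := by
  have h0 : (q : ℂ) ≠ 0 := q.ne_zero
  have ha : (a : ℂ) ≠ 0 := a.ne_zero
  refine ⟨evalRep_loopGen a r hq _, fun g => ?_⟩
  cases g <;> simp only [chevalley, jimboEv, map_mul, map_smul, evalRep_loopGen, spinRep_sl2Gen]
  case K0 => simp [evalGen]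
  case K0inv => simp [evalGen]
  case X0p =>
    apply spin_ext; intro j hj
    rw [Module.End.mul_apply, evalGen, spinGen_Kinv, map_smul, evalGen_Xm, LinearMap.smul_apply,
      spinGen_xm, smul_smul, smul_smul, evPt_natCast_succ, zpow_neg, zpow_weight, zpow_one]
    congr 1
    field_simp
  case X0m =>
    apply spin_ext; intro j hj
    rw [Module.End.mul_apply, LinearMap.smul_apply]
    rcases j with _ | j
    · rw [evalGen_Xp_zero, spinGen_xp_zero, map_zero, smul_zero]
    · rw [evalGen_Xp_succ, evalGen, map_smul, spinGen_K, spinGen_xp_succ, smul_smul, smul_smul,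
        evPt_natCast_succ, zpow_neg_one, zpow_weight]
      congr 1
      field_simp
  case K1 => rfl
  case K1inv => rfl
  case X1p =>
    apply spin_ext; intro j hj
    rw [evalGen_Xp, zpow_zero, one_smul]
  case X1m =>
    apply spin_ext; intro j hj
    rw [evalGen_Xm, zpow_zero, one_mul, spinGen_xm]

end EvaluationRelations

/-! ### Generation by the Chevalley generators -/

section Generation

variable {q : ℂˣ} {A : Type*} [Ring A] [Algebra ℂ A]

theorem toUqAff_rel {x y : LoopFree} (h : LoopRel q x y) : toUqAff q x = toUqAff q y :=
  RingQuot.mkAlgHom_rel ℂ h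

theorem map_eq_of_mul_eq_one {B : Type*} [Ring B] [Algebra ℂ B] {f g : A →ₐ[ℂ] B} {x y : A}
    (h : f x = g x) (hxy : x * y = 1) (hyx : y * x = 1) : f y = g y := by
  apply left_inv_eq_right_inv (a := f x)
  · rw [← map_mul, hyx, map_one]
  · rw [h, ← map_mul, hxy, map_one]

/-- A left-invertible factor on which two homomorphisms agree may be cancelled. -/
theorem map_eq_of_mul_left {B : Type*} [Ring B] [Algebra ℂ B] {f g : A →ₐ[ℂ] B} {u u' y : A}
    (h' : f u' = g u') (hu : u' * u = 1) (h : f (u * y) = g (u * y)) : f y = g y := by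
  rw [← one_mul y, ← hu, mul_assoc, map_mul f u', map_mul g u', h, h']

theorem Chalf_mul_ChalfInv : loopGen q .Chalf * loopGen q .ChalfInv = 1 := by
  simpa [loopGen] using toUqAff_rel (q := q) .C_mul_Cinv

/-- Only the other order is a defining relation; this one follows by centrality. -/
theorem ChalfInv_mul_Chalf : loopGen q .ChalfInv * loopGen q .Chalf = 1 := by
  have := toUqAff_rel (q := q) (.C_central .ChalfInv)
  rw [map_mul, map_mul] at this
  exact this.symm.trans Chalf_mul_ChalfInv

theorem K_mul_Kinv : loopGen q .K * loopGen q .Kinv = 1 := by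
  simpa [loopGen] using toUqAff_rel (q := q) .K_mul_Kinv

theorem Kinv_mul_K : loopGen q .Kinv * loopGen q .K = 1 := by
  simpa [loopGen] using toUqAff_rel (q := q) .Kinv_mul_K

theorem toUqAff_cHalfPow_natCast (n : ℕ) : toUqAff q (cHalfPow n) = loopGen q .Chalf ^ n := by
  simp [cHalfPow, loopGen]

theorem toUqAff_cHalfPow_neg_natCast (n : ℕ) :
    toUqAff q (cHalfPow (-n)) = loopGen q .ChalfInv ^ n := by
  rcases n with _ | n
  · simp [cHalfPow]
  · rw [cHalfPow, if_neg (by omega), neg_neg, Int.toNat_natCast, map_pow]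
    rfl

theorem cHalfPow_neg_mul (n : ℤ) : toUqAff q (cHalfPow (-n)) * toUqAff q (cHalfPow n) = 1 := by
  have hc : Commute (loopGen q .Chalf) (loopGen q .ChalfInv) :=
    Chalf_mul_ChalfInv.trans ChalfInv_mul_Chalf.symm
  obtain ⟨m, rfl | rfl⟩ := n.eq_nat_or_neg
  · rw [toUqAff_cHalfPow_natCast, toUqAff_cHalfPow_neg_natCast, ← hc.symm.mul_pow,
      ChalfInv_mul_Chalf, one_pow]
  · rw [neg_neg, toUqAff_cHalfPow_natCast, toUqAff_cHalfPow_neg_natCast, ← hc.mul_pow,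
      Chalf_mul_ChalfInv, one_pow]

theorem algHom_ext_loopGen {f g : UqAff q →ₐ[ℂ] A}
    (h : ∀ x, f (loopGen q x) = g (loopGen q x)) : f = g := by
  apply RingQuot.ringQuot_ext'
  apply FreeAlgebra.hom_ext
  funext x
  exact h x

variable {f g : UqAff q →ₐ[ℂ] A}

theorem map_cHalfPow_eq (hC : f (loopGen q .Chalf) = g (loopGen q .Chalf)) (n : ℤ) :
    f (toUqAff q (cHalfPow n)) = g (toUqAff q (cHalfPow n)) := by
  have hCi := map_eq_of_mul_eq_one hC Chalf_mul_ChalfInv ChalfInv_mul_Chalf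
  obtain ⟨m, rfl | rfl⟩ := n.eq_nat_or_neg
  · rw [toUqAff_cHalfPow_natCast, map_pow, map_pow, hC]
  · rw [toUqAff_cHalfPow_neg_natCast, map_pow, map_pow, hCi]

theorem map_cHalfPow_mul_cancel (hC : f (loopGen q .Chalf) = g (loopGen q .Chalf)) {n : ℤ}
    {x : LoopFree} (h : f (toUqAff q (cHalfPow n * x)) = g (toUqAff q (cHalfPow n * x))) :
    f (toUqAff q x) = g (toUqAff q x) := by
  rw [map_mul (toUqAff q)] at h
  exact map_eq_of_mul_left (map_cHalfPow_eq hC (-n)) (cHalfPow_neg_mul n) h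

theorem map_commutator_eq {x y : LoopFree} (hx : f (toUqAff q x) = g (toUqAff q x))
    (hy : f (toUqAff q y) = g (toUqAff q y)) :
    f (toUqAff q (x * y - y * x)) = g (toUqAff q (x * y - y * x)) := by
  simp only [map_sub, map_mul, hx, hy]

theorem map_smul_cancel {c : ℂ} (hc : c ≠ 0) {x : LoopFree}
    (h : f (toUqAff q (c • x)) = g (toUqAff q (c • x))) : f (toUqAff q x) = g (toUqAff q x) := by
  simp only [map_smul] at h
  exact smul_right_injective A hc h

/-- `[H_n, X⁺_m]` is a nonzero multiple of `X⁺_{n+m}` up to an invertible power of `C^{1/2}`, so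
agreement propagates along the index. -/
theorem map_Xp_eq (hC : f (loopGen q .Chalf) = g (loopGen q .Chalf)) {n m : ℤ} (hn : n ≠ 0)
    (hc : qInt q (2 * n) ≠ 0) (hH : f (loopGen q (.H n hn)) = g (loopGen q (.H n hn)))
    (hX : f (loopGen q (.Xp m)) = g (loopGen q (.Xp m))) :
    f (loopGen q (.Xp (n + m))) = g (loopGen q (.Xp (n + m))) := by
  have h := map_commutator_eq hH hX
  rw [toUqAff_rel (.H_Xp n m hn)] at h
  exact map_cHalfPow_mul_cancel hC (map_smul_cancel
    (mul_ne_zero (one_div_ne_zero (Int.cast_ne_zero.mpr hn)) hc) h)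

theorem map_Xm_eq (hC : f (loopGen q .Chalf) = g (loopGen q .Chalf)) {n m : ℤ} (hn : n ≠ 0)
    (hc : qInt q (2 * n) ≠ 0) (hH : f (loopGen q (.H n hn)) = g (loopGen q (.H n hn)))
    (hX : f (loopGen q (.Xm m)) = g (loopGen q (.Xm m))) :
    f (loopGen q (.Xm (n + m))) = g (loopGen q (.Xm (n + m))) := by
  have h := map_commutator_eq hH hX
  rw [toUqAff_rel (.H_Xm n m hn)] at h
  exact map_cHalfPow_mul_cancel hC (map_smul_cancel
    (neg_ne_zero.mpr (mul_ne_zero (one_div_ne_zero (Int.cast_ne_zero.mpr hn)) hc)) h)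

/-- In positive total degree `Φ⁻` vanishes, so the commutator isolates `Φ⁺`. -/
theorem map_phiPlus_eq (hd : (q : ℂ) - (q : ℂ)⁻¹ ≠ 0)
    (hC : f (loopGen q .Chalf) = g (loopGen q .Chalf)) {n m : ℤ}
    (hn : f (loopGen q (.Xp n)) = g (loopGen q (.Xp n)))
    (hm : f (loopGen q (.Xm m)) = g (loopGen q (.Xm m))) (h : 0 < n + m) :
    f (phiPlus q (n + m)) = g (phiPlus q (n + m)) := by
  have hX := map_commutator_eq hn hm
  rw [toUqAff_rel (.Xp_Xm n m), phiMinusFree, if_pos h, mul_zero, sub_zero] at hX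
  exact map_cHalfPow_mul_cancel hC (map_smul_cancel (inv_ne_zero hd) hX)

theorem map_phiMinus_eq (hd : (q : ℂ) - (q : ℂ)⁻¹ ≠ 0)
    (hC : f (loopGen q .Chalf) = g (loopGen q .Chalf)) {n m : ℤ}
    (hn : f (loopGen q (.Xp n)) = g (loopGen q (.Xp n)))
    (hm : f (loopGen q (.Xm m)) = g (loopGen q (.Xm m))) (h : n + m < 0) :
    f (phiMinus q (n + m)) = g (phiMinus q (n + m)) := by
  have hX := map_commutator_eq hn hm
  rw [toUqAff_rel (.Xp_Xm n m), phiPlusFree, if_pos h, mul_zero, zero_sub, smul_neg,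
    ← neg_smul] at hX
  exact map_cHalfPow_mul_cancel hC (map_smul_cancel (neg_ne_zero.mpr (inv_ne_zero hd)) hX)

/-- `K⁻¹Φ⁺_n` is `(q - q⁻¹) H_n` plus a noncommutative polynomial in the `H_s` with `0 < s < n`, so
`H_n` can be recovered recursively. -/
theorem map_H_eq_of_pos (hd : (q : ℂ) - (q : ℂ)⁻¹ ≠ 0)
    (hK : f (loopGen q .Kinv) = g (loopGen q .Kinv)) {n : ℕ} (hn : (n : ℤ) ≠ 0)
    (hphi : f (phiPlus q n) = g (phiPlus q n))
    (hH : ∀ (s : ℕ) (hs : (s : ℤ) ≠ 0), s < n →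
      f (loopGen q (.H s hs)) = g (loopGen q (.H s hs))) :
    f (loopGen q (.H n hn)) = g (loopGen q (.H n hn)) := by
  have hn' : n ≠ 0 := by exact_mod_cast hn
  rw [phiPlus, phiPlusFree, if_neg (by omega), Int.toNat_natCast, map_mul (toUqAff q)] at hphi
  have h := map_eq_of_mul_left hK Kinv_mul_K hphi
  have hcomp : ∀ (F : UqAff q →ₐ[ℂ] A) x, F (toUqAff q x) = (F.comp (toUqAff q)) x :=
    fun _ _ => rfl
  rw [hcomp, hcomp, map_expCoeff, map_expCoeff] at h
  have h1 := coeff_eq_of_expCoeff_eq (by simp [hSeriesPlus]) (by simp [hSeriesPlus]) hn' ?_ h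
  · simp only [PowerSeries.coeff_map, PowerSeries.coeff_smul, hSeriesPlus, PowerSeries.coeff_mk,
      dif_neg hn', RingHom.coe_coe] at h1
    exact map_smul_cancel hd h1
  · intro s hs
    simp only [PowerSeries.coeff_map, PowerSeries.coeff_smul, hSeriesPlus, PowerSeries.coeff_mk,
      RingHom.coe_coe]
    split_ifs with h0
    · simp
    · simp only [map_smul]
      congr 1
      exact hH s (by omega) hs

theorem map_H_eq_of_neg (hd : (q : ℂ) - (q : ℂ)⁻¹ ≠ 0)
    (hK : f (loopGen q .K) = g (loopGen q .K)) {n : ℕ} (hn : -(n : ℤ) ≠ 0)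
    (hphi : f (phiMinus q (-n)) = g (phiMinus q (-n)))
    (hH : ∀ (s : ℕ) (hs : -(s : ℤ) ≠ 0), s < n →
      f (loopGen q (.H (-s) hs)) = g (loopGen q (.H (-s) hs))) :
    f (loopGen q (.H (-n) hn)) = g (loopGen q (.H (-n) hn)) := by
  have hn' : n ≠ 0 := by omega
  rw [phiMinus, phiMinusFree, if_neg (by omega), neg_neg, Int.toNat_natCast,
    map_mul (toUqAff q)] at hphi
  have h := map_eq_of_mul_left hK K_mul_Kinv hphi
  have hcomp : ∀ (F : UqAff q →ₐ[ℂ] A) x, F (toUqAff q x) = (F.comp (toUqAff q)) x :=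
    fun _ _ => rfl
  rw [hcomp, hcomp, map_expCoeff, map_expCoeff] at h
  have h1 := coeff_eq_of_expCoeff_eq (by simp [hSeriesMinus]) (by simp [hSeriesMinus]) hn' ?_ h
  · simp only [PowerSeries.coeff_map, PowerSeries.coeff_smul, hSeriesMinus, PowerSeries.coeff_mk,
      dif_neg hn', RingHom.coe_coe] at h1
    exact map_smul_cancel (neg_ne_zero.mpr hd) h1
  · intro s hs
    simp only [PowerSeries.coeff_map, PowerSeries.coeff_smul, hSeriesMinus, PowerSeries.coeff_mk,
      RingHom.coe_coe]
    split_ifs with h0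
    · simp
    · simp only [map_smul]
      congr 1
      exact hH s (by omega) hs

/-- Together with `C^{1/2}`, the Chevalley generators determine a homomorphism. -/
theorem algHom_ext_chevalley (hq : ∀ n : ℕ, 0 < n → q ^ n ≠ 1)
    (hC : f (loopGen q .Chalf) = g (loopGen q .Chalf))
    (h : ∀ c, f (chevalley q c) = g (chevalley q c)) : f = g := by
  have hd := sub_inv_ne_zero hq
  have hCi := map_eq_of_mul_eq_one hC Chalf_mul_ChalfInv ChalfInv_mul_Chalf
  have hK : f (loopGen q .K) = g (loopGen q .K) := h .K1
  have hKi : f (loopGen q .Kinv) = g (loopGen q .Kinv) := h .K1inv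
  have hp0 : f (loopGen q (.Xp 0)) = g (loopGen q (.Xp 0)) := h .X1p
  have hm0 : f (loopGen q (.Xm 0)) = g (loopGen q (.Xm 0)) := h .X1m
  have hp1 : f (loopGen q (.Xp (-1))) = g (loopGen q (.Xp (-1))) :=
    map_eq_of_mul_left hKi Kinv_mul_K (h .X0m)
  have hm1 : f (loopGen q (.Xm 1)) = g (loopGen q (.Xm 1)) := by
    have := h .X0p
    rw [chevalley, map_mul, map_mul] at this
    rw [← mul_one (loopGen q (.Xm 1)), ← Kinv_mul_K, ← mul_assoc, map_mul, map_mul, map_mul,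
      map_mul, this, hK]
  -- `[X⁺_0, X⁻_1]` gives `Φ⁺_1`, where no lower `H_s` occurs; `[X⁺_{-1}, X⁻_0]` likewise gives
  -- `H_{-1}`.
  have hH1 : f (loopGen q (.H 1 one_ne_zero)) = g (loopGen q (.H 1 one_ne_zero)) :=
    map_H_eq_of_pos (n := 1) hd hKi (by simp)
      (map_phiPlus_eq hd hC hp0 hm1 (by norm_num)) (fun s hs hs' => by omega)
  have hHm1 : f (loopGen q (.H (-1) (by simp))) = g (loopGen q (.H (-1) (by simp))) :=
    map_H_eq_of_neg (n := 1) hd hK (by simp)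
      (map_phiMinus_eq hd hC hp1 hm0 (by norm_num)) (fun s hs hs' => by omega)
  -- Brackets with `H_1` and `H_{-1}` move the index up and down by one.
  have hXp : ∀ n : ℤ, f (loopGen q (.Xp n)) = g (loopGen q (.Xp n)) := by
    intro n
    induction n with
    | zero => exact hp0
    | succ n ih =>
      rw [add_comm]
      exact map_Xp_eq hC _ (qInt_ne_zero hq (by norm_num)) hH1 ih
    | pred n ih =>
      rw [sub_eq_neg_add]
      exact map_Xp_eq hC _ (qInt_ne_zero hq (by norm_num)) hHm1 ih
  have hXm : ∀ n : ℤ, f (loopGen q (.Xm n)) = g (loopGen q (.Xm n)) := by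
    intro n
    induction n with
    | zero => exact hm0
    | succ n ih =>
      rw [add_comm]
      exact map_Xm_eq hC _ (qInt_ne_zero hq (by norm_num)) hH1 ih
    | pred n ih =>
      rw [sub_eq_neg_add]
      exact map_Xm_eq hC _ (qInt_ne_zero hq (by norm_num)) hHm1 ih
  -- Now `[X⁺_n, X⁻_0]` supplies `Φ⁺_n` for every `n > 0`.
  have hHp : ∀ (n : ℕ) (hn : (n : ℤ) ≠ 0),
      f (loopGen q (.H n hn)) = g (loopGen q (.H n hn)) := by
    intro n
    induction n using Nat.strong_induction_on with
    | _ n ih =>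
      intro hn
      have := map_phiPlus_eq hd hC (hXp n) (hXm 0) (by omega)
      rw [add_zero] at this
      exact map_H_eq_of_pos hd hKi hn this fun s hs hs' => ih s hs' hs
  have hHn : ∀ (n : ℕ) (hn : -(n : ℤ) ≠ 0),
      f (loopGen q (.H (-n) hn)) = g (loopGen q (.H (-n) hn)) := by
    intro n
    induction n using Nat.strong_induction_on with
    | _ n ih =>
      intro hn
      have := map_phiMinus_eq hd hC (hXp (-n)) (hXm 0) (by omega)
      rw [add_zero] at this
      exact map_H_eq_of_neg hd hK hn this fun s hs hs' => ih s hs' hs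
  apply algHom_ext_loopGen
  intro x
  cases x with
  | Chalf => exact hC
  | ChalfInv => exact hCi
  | K => exact hK
  | Kinv => exact hKi
  | H n hn =>
    obtain ⟨m, rfl | rfl⟩ := n.eq_nat_or_neg
    · exact hHp m hn
    · exact hHn m hn
  | Xp n => exact hXp n
  | Xm n => exact hXm n

theorem eq_evalRep (hq : ∀ n : ℕ, 0 < n → q ^ n ≠ 1) {a : ℂˣ} {r : ℕ}
    {ρ : UqAff q →ₐ[ℂ] Module.End ℂ (SpinSpace r)} (h : IsEvaluationRep q a r ρ) :
    ρ = evalRep a r hq := by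
  have h' := isEvaluationRep_evalRep a r hq
  exact algHom_ext_chevalley hq (h.Chalf.trans h'.Chalf.symm)
    fun c => (h.chevalley c).trans (h'.chevalley c).symm

end Generation

/-! ### Rational functions and their expansions -/

/-- The linear polynomial `1 - c u`. -/
def linPoly (c : ℂ) : ℂ[X] := 1 - C c * X

theorem coe_linPoly (c : ℂ) : (linPoly c : PowerSeries ℂ) = linFactor c := by
  simp [linPoly, linFactor]

theorem coeff_zero_linPoly (c : ℂ) : (linPoly c).coeff 0 = 1 := by
  simp [linPoly]

theorem linPoly_ne_zero (c : ℂ) : linPoly c ≠ 0 := fun h => by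
  simpa [h] using coeff_zero_linPoly c

theorem natDegree_linPoly {c : ℂ} (hc : c ≠ 0) : (linPoly c).natDegree = 1 := by
  have : linPoly c = C (-c) * X + C 1 := by simp [linPoly]; ring
  rw [this, natDegree_linear (neg_ne_zero.mpr hc)]

/-- Reversal turns `1 - cu` into `w - c`, so passing to infinity inverts the point at the cost of
the constant `-c`. -/
theorem coe_reverse_linPoly {c : ℂ} (hc : c ≠ 0) :
    ((linPoly c).reverse : PowerSeries ℂ) = PowerSeries.C (-c) * linFactor c⁻¹ := by
  have h1 : (linPoly c).reverse = X - C c := by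
    rw [reverse, natDegree_linPoly hc, linPoly, reflect_sub, reflect_C_mul, reflect_one]
    simp
  rw [h1, linFactor, mul_sub, ← mul_assoc, ← map_mul]
  simp [hc]
  ring

/-! ### The substitution `u ↦ q⁻²u` on polynomials -/

section qShift

variable (q : ℂˣ)

theorem qShift_mul (P Q : ℂ[X]) : qShift q (P * Q) = qShift q P * qShift q Q := mul_comp ..

theorem qShift_one : qShift q 1 = 1 := one_comp

theorem qShift_prod {ι : Type*} (s : Finset ι) (P : ι → ℂ[X]) :
    qShift q (∏ i ∈ s, P i) = ∏ i ∈ s, qShift q (P i) := prod_comp ..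

theorem qShift_linPoly (c : ℂ) : qShift q (linPoly c) = linPoly ((q : ℂ) ^ (-2 : ℤ) * c) := by
  simp only [qShift, linPoly, sub_comp, one_comp, mul_comp, C_comp, X_comp, ← mul_assoc, ← C_mul]
  rw [mul_comm c]

theorem coeff_qShift (P : ℂ[X]) (n : ℕ) :
    (qShift q P).coeff n = ((q : ℂ) ^ (-2 : ℤ)) ^ n * P.coeff n := by
  rw [qShift, comp_C_mul_X_coeff, mul_comm]

theorem coeff_zero_qShift (P : ℂ[X]) : (qShift q P).coeff 0 = P.coeff 0 := by
  simp [coeff_qShift]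

theorem natDegree_qShift (P : ℂ[X]) : (qShift q P).natDegree = P.natDegree := by
  rw [qShift, natDegree_comp, natDegree_C_mul_X _ (zpow_ne_zero _ q.ne_zero), mul_one]

theorem coe_qShift (P : ℂ[X]) :
    (qShift q P : PowerSeries ℂ) = PowerSeries.rescale ((q : ℂ) ^ (-2 : ℤ)) P := by
  ext n
  rw [PowerSeries.coeff_rescale, coeff_coe, coeff_coe, coeff_qShift]

end qShift

theorem constantCoeff_coe_eq (P : ℂ[X]) :
    PowerSeries.constantCoeff (P : PowerSeries ℂ) = P.coeff 0 := by
  rw [← PowerSeries.coeff_zero_eq_constantCoeff_apply, coeff_coe]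

theorem expandZero_mul {N D : ℂ[X]} (hD : D.coeff 0 ≠ 0) :
    expandZero N D * (D : PowerSeries ℂ) = N := by
  rw [expandZero, mul_assoc, PowerSeries.inv_mul_cancel _ (by rwa [constantCoeff_coe_eq]), mul_one]

theorem coeff_zero_expandZero {N D : ℂ[X]} (hN : N.coeff 0 = 1) (hD : D.coeff 0 = 1) :
    PowerSeries.coeff 0 (expandZero N D) = 1 := by
  have h := congrArg PowerSeries.constantCoeff
    (expandZero_mul (N := N) (D := D) (by rw [hD]; exact one_ne_zero))
  rw [map_mul, constantCoeff_coe_eq, constantCoeff_coe_eq, hN, hD, mul_one] at h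
  rwa [PowerSeries.coeff_zero_eq_constantCoeff_apply]

/-- Equal degrees make both reflections reversals, which are multiplicative. -/
theorem expandInfty_mul {N D : ℂ[X]} (hD : D ≠ 0) (h : N.natDegree = D.natDegree) :
    expandInfty N D * (D.reverse : PowerSeries ℂ) = (N.reverse : PowerSeries ℂ) := by
  have hr : N.reflect D.natDegree = N.reverse := by rw [reverse, h]
  have hr' : D.reflect D.natDegree = D.reverse := rfl
  rw [expandInfty, hr, hr', mul_assoc, PowerSeries.inv_mul_cancel, mul_one]
  rw [constantCoeff_coe_eq, coeff_zero_reverse]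
  exact leadingCoeff_ne_zero.mpr hD

theorem coeff_zero_mul_eq_one {P Q : ℂ[X]} (hP : P.coeff 0 = 1) (hQ : Q.coeff 0 = 1) :
    (P * Q).coeff 0 = 1 := by
  rw [mul_coeff_zero, hP, hQ, mul_one]

/-- A rational function that is regular and equal to `1` at `0` is determined by the ratio of its
shift and itself. -/
theorem eq_of_qShift_mul_eq {q : ℂˣ} (hq : ∀ n : ℕ, 0 < n → q ^ n ≠ 1) {T T' : ℂ[X]}
    (hT : T.coeff 0 = 1) (hT' : T'.coeff 0 = 1) (h : qShift q T * T' = qShift q T' * T) :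
    T = T' := by
  have hT'0 : T'.coeff 0 ≠ 0 := by rw [hT']; exact one_ne_zero
  have hF := expandZero_mul (N := T) hT'0
  have hF0 := coeff_zero_expandZero hT hT'
  set F := expandZero T T'
  have hne : (T' : PowerSeries ℂ) ≠ 0 := fun h0 => hT'0 (by rw [← coeff_coe, h0, map_zero])
  have hne' : (qShift q T' : PowerSeries ℂ) ≠ 0 := fun h0 => hT'0 (by
    rw [← coeff_zero_qShift q, ← coeff_coe, h0, map_zero])
  have h1 := congrArg (fun P : ℂ[X] => (P : PowerSeries ℂ)) h
  simp only [Polynomial.coe_mul] at h1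
  -- The hypothesis says that `F = T / T'` is invariant under `u ↦ q⁻²u`. Its coefficient of `u^n`
  -- is then fixed by `q^{-2n} ≠ 1` for `n > 0`, hence zero.
  have h2 : PowerSeries.rescale ((q : ℂ) ^ (-2 : ℤ)) F = F := by
    apply mul_right_cancel₀ (mul_ne_zero hne' hne)
    rw [coe_qShift q T, ← hF, map_mul, ← coe_qShift] at h1
    linear_combination h1
  have h3 : F = 1 := by
    ext n
    rcases n with _ | n
    · simpa using hF0
    · have h4 := congrArg (PowerSeries.coeff (n + 1)) h2
      rw [PowerSeries.coeff_rescale, ← zpow_natCast, ← zpow_mul] at h4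
      have h5 := zpow_ne_one hq (n := -2 * ((n + 1 : ℕ) : ℤ)) (by push_cast; omega)
      rw [PowerSeries.coeff_one, if_neg n.succ_ne_zero]
      by_contra h6
      exact h5 (mul_right_cancel₀ h6 (by rw [h4, one_mul]))
  rw [h3, one_mul] at hF
  exact (Polynomial.coe_injective ℂ hF).symm

/-- The expansion `Ψ⁺` determines the rational function `Q / R`. -/
theorem mul_eq_mul_of_psiPlus_eq {q : ℂˣ} (hq : ∀ n : ℕ, 0 < n → q ^ n ≠ 1) {Q R Q' R' : ℂ[X]}
    (hQ : Q.coeff 0 = 1) (hR : R.coeff 0 = 1) (hQ' : Q'.coeff 0 = 1) (hR' : R'.coeff 0 = 1)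
    (h : psiPlus q Q R = psiPlus q Q' R') : Q * R' = Q' * R := by
  have key : ∀ {P : ℂ[X]}, P.coeff 0 = 1 → (qShift q P).coeff 0 = 1 := fun hP => by
    rw [coeff_zero_qShift, hP]
  have hD := coeff_zero_mul_eq_one hQ (key hR)
  have hD' := coeff_zero_mul_eq_one hQ' (key hR')
  -- The expansions start with `1`, so the constant terms show that the two prefactors are equal and
  -- may be cancelled.
  have h0 := congrArg (PowerSeries.coeff 0) h
  rw [psiPlus, psiPlus, PowerSeries.coeff_smul, PowerSeries.coeff_smul,
    coeff_zero_expandZero (coeff_zero_mul_eq_one (key hQ) hR) hD,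
    coeff_zero_expandZero (coeff_zero_mul_eq_one (key hQ') hR') hD', smul_eq_mul, smul_eq_mul,
    mul_one, mul_one] at h0
  rw [psiPlus, psiPlus, h0] at h
  have h1 := smul_right_injective _ (zpow_ne_zero _ q.ne_zero) h
  have e := expandZero_mul (N := qShift q Q * R) (D := Q * qShift q R) (by rw [hD]; simp)
  have e' := expandZero_mul (N := qShift q Q' * R') (D := Q' * qShift q R') (by rw [hD']; simp)
  rw [h1] at e
  simp only [Polynomial.coe_mul] at e e'
  apply eq_of_qShift_mul_eq hq (coeff_zero_mul_eq_one hQ hR') (coeff_zero_mul_eq_one hQ' hR)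
  rw [qShift_mul, qShift_mul]
  apply Polynomial.coe_injective ℂ
  simp only [Polynomial.coe_mul]
  linear_combination -(Q' * qShift q R' : PowerSeries ℂ) * e + (Q * qShift q R : PowerSeries ℂ) * e'

/-! ### The loop-weights of the evaluation representation -/

section Weights

variable (q a : ℂˣ) (r : ℕ)

theorem polyQ_eq (k : ℕ) :
    polyQ q a r k = ∏ m ∈ Finset.Icc (k + 1) r, linPoly (evPt q a r m) := rfl

/-- The points in `R_{k,a}` are `c_0, …, c_{k-1}`, while those in `Q_{k,a}` are `c_{k+1}, …, c_r`.
-/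
theorem polyR_eq (k : ℕ) :
    polyR q a r k = ∏ m ∈ Finset.Icc 1 k, linPoly (evPt q a r ((m : ℤ) - 1)) := by
  refine Finset.prod_congr rfl fun m _ => ?_
  rw [linPoly, evPt, show (r : ℤ) - 2 * (m - 1) + 1 = r - 2 * m + 3 by ring]

theorem coeff_zero_polyQ (k : ℕ) : (polyQ q a r k).coeff 0 = 1 := by
  rw [polyQ_eq, coeff_zero_prod]
  exact Finset.prod_eq_one fun m _ => coeff_zero_linPoly _

theorem coeff_zero_polyR (k : ℕ) : (polyR q a r k).coeff 0 = 1 := by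
  rw [polyR_eq, coeff_zero_prod]
  exact Finset.prod_eq_one fun m _ => coeff_zero_linPoly _

theorem polyR_zero : polyR q a r 0 = 1 := by simp [polyR]

theorem natDegree_polyQ (k : ℕ) : (polyQ q a r k).natDegree = r - k := by
  rw [polyQ_eq, natDegree_prod _ _ fun m _ => linPoly_ne_zero _]
  simp [natDegree_linPoly (evPt_ne_zero q a r _)]

theorem natDegree_polyR (k : ℕ) : (polyR q a r k).natDegree = k := by
  rw [polyR_eq, natDegree_prod _ _ fun m _ => linPoly_ne_zero _]
  simp [natDegree_linPoly (evPt_ne_zero q a r _)]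

/-- Telescoping: the shift moves `c_{k+1}, …, c_r` to `c_{k+2}, …, c_{r+1}`, so only the end factors
differ. -/
theorem qShift_polyQ_mul {k : ℕ} (hk : k ≤ r) :
    qShift q (polyQ q a r k) * linPoly (evPt q a r (k + 1)) =
      polyQ q a r k * linPoly (evPt q a r (r + 1)) := by
  rw [polyQ_eq, qShift_prod]
  simp only [qShift_linPoly, ← evPt_succ]
  have key : ∀ t, k ≤ t →
      (∏ m ∈ Finset.Icc (k + 1) t, linPoly (evPt q a r (m + 1))) * linPoly (evPt q a r (k + 1)) =
      (∏ m ∈ Finset.Icc (k + 1) t, linPoly (evPt q a r m)) * linPoly (evPt q a r (t + 1)) := by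
    intro t ht
    induction t, ht using Nat.le_induction with
    | base => simp
    | succ t ht ih =>
      rw [Finset.prod_Icc_succ_top (by omega), Finset.prod_Icc_succ_top (by omega)]
      push_cast
      linear_combination linPoly (evPt q a r (t + 1 + 1)) * ih
  exact key r hk

theorem polyR_mul (k : ℕ) : polyR q a r k * linPoly (evPt q a r k) =
    qShift q (polyR q a r k) * linPoly (evPt q a r 0) := by
  rw [polyR_eq, qShift_prod]
  simp only [qShift_linPoly, ← evPt_succ, sub_add_cancel]
  induction k with
  | zero => simp
  | succ k ih =>
    rw [Finset.prod_Icc_succ_top (by omega), Finset.prod_Icc_succ_top (by omega)]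
    push_cast
    rw [add_sub_cancel_right]
    linear_combination linPoly (evPt q a r (k + 1)) * ih

/-- The loop-weight in cross-multiplied form: up to its prefactor it is the rational function whose
logarithm is `phiPlusLog`. -/
theorem qShift_polyQ_mul_polyR_mul {k : ℕ} (hk : k ≤ r) :
    (qShift q (polyQ q a r k) * polyR q a r k) *
        (linPoly (evPt q a r (k + 1)) * linPoly (evPt q a r k)) =
      (polyQ q a r k * qShift q (polyR q a r k)) *
        (linPoly (evPt q a r 0) * linPoly (evPt q a r (r + 1))) := by
  linear_combination polyR q a r k * linPoly (evPt q a r k) * qShift_polyQ_mul q a r hk +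
    polyQ q a r k * linPoly (evPt q a r (r + 1)) * polyR_mul q a r k

variable {q}

theorem psiPlus_polyQ_polyR (hq : ∀ n : ℕ, 0 < n → q ^ n ≠ 1) {k : ℕ} (hk : k ≤ r) :
    psiPlus q (polyQ q a r k) (polyR q a r k) = PowerSeries.mk (phiPlusEig q a r k) := by
  have hD : (polyQ q a r k * qShift q (polyR q a r k)).coeff 0 ≠ 0 := by
    rw [mul_coeff_zero, coeff_zero_qShift, coeff_zero_polyQ, coeff_zero_polyR, mul_one]
    exact one_ne_zero
  have hD' : ((polyQ q a r k * qShift q (polyR q a r k) : ℂ[X]) : PowerSeries ℂ) ≠ 0 :=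
    fun h => hD (by rw [← coeff_coe, h, map_zero])
  have h1 : expandZero (qShift q (polyQ q a r k) * polyR q a r k)
      (polyQ q a r k * qShift q (polyR q a r k)) =
        PowerSeries.mk (expCoeff (phiPlusLog q a r k)) := by
    have e1 := expandZero_mul (N := qShift q (polyQ q a r k) * polyR q a r k) hD
    have e2 := congrArg (fun P : ℂ[X] => (P : PowerSeries ℂ))
      (qShift_polyQ_mul_polyR_mul q a r hk)
    have e3 := mk_expCoeff_logQuot_mul (evPt q a r (k + 1)) (evPt q a r k) (evPt q a r 0)
      (evPt q a r (r + 1))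
    simp only [Polynomial.coe_mul _ (linPoly _ * linPoly _), Polynomial.coe_mul (linPoly _),
      coe_linPoly] at e2
    rw [← e1, ← e3] at e2
    apply mul_right_cancel₀ (mul_ne_zero hD' (mul_ne_zero (linFactor_ne_zero (evPt q a r (k + 1)))
      (linFactor_ne_zero (evPt q a r k))))
    rw [phiPlusLog]
    linear_combination e2
  ext n
  rw [psiPlus, h1, natDegree_polyQ, natDegree_polyR, PowerSeries.coeff_smul, PowerSeries.coeff_mk,
    PowerSeries.coeff_mk, phiPlusEig_eq a r hq, smul_eq_mul]
  congr 2
  omega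

theorem psiMinus_polyQ_polyR (hq : ∀ n : ℕ, 0 < n → q ^ n ≠ 1) {k : ℕ} (hk : k ≤ r) :
    psiMinus q (polyQ q a r k) (polyR q a r k) = PowerSeries.mk (phiMinusEig q a r k) := by
  have hQ0 : polyQ q a r k ≠ 0 := fun h => by simpa [h] using coeff_zero_polyQ q a r k
  have hR0 : polyR q a r k ≠ 0 := fun h => by simpa [h] using coeff_zero_polyR q a r k
  have hsh : ∀ {P : ℂ[X]}, P.coeff 0 = 1 → qShift q P ≠ 0 := fun {P} h h' => by
    have := coeff_zero_qShift q P
    rw [h', h] at this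
    simp at this
  have hRs := hsh (coeff_zero_polyR q a r k)
  have hQs := hsh (coeff_zero_polyQ q a r k)
  have hD := mul_ne_zero hQ0 hRs
  have hdeg : (qShift q (polyQ q a r k) * polyR q a r k).natDegree =
      (polyQ q a r k * qShift q (polyR q a r k)).natDegree := by
    rw [natDegree_mul hQs hR0, natDegree_mul hQ0 hRs, natDegree_qShift, natDegree_qShift]
  have hD' : ((polyQ q a r k * qShift q (polyR q a r k) : ℂ[X]).reverse : PowerSeries ℂ) ≠ 0 :=
    fun h => hD (reverse_eq_zero.mp (Polynomial.coe_injective ℂ (by rw [h, Polynomial.coe_zero])))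
  have hb := evPt_ne_zero q a r
  -- Reversing the linear factors leaves these constants on the two sides; `hc` below shows that
  -- they convert the prefactor `q^{r-2k}` into the `K⁻¹`-eigenvalue.
  have h1 : PowerSeries.C (evPt q a r (k + 1) * evPt q a r k) *
      expandInfty (qShift q (polyQ q a r k) * polyR q a r k)
        (polyQ q a r k * qShift q (polyR q a r k)) =
      PowerSeries.C (evPt q a r 0 * evPt q a r (r + 1)) *
        PowerSeries.mk (expCoeff (phiMinusLog q a r k)) := by
    have e1 := expandInfty_mul hD hdeg
    have e2 := congrArg (fun P : ℂ[X] => (P.reverse : PowerSeries ℂ))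
      (qShift_polyQ_mul_polyR_mul q a r hk)
    have e3 := mk_expCoeff_logQuot_mul (evPt q a r (k + 1))⁻¹ (evPt q a r k)⁻¹ (evPt q a r 0)⁻¹
      (evPt q a r (r + 1))⁻¹
    simp only [reverse_mul_of_domain _ (linPoly _ * linPoly _), reverse_mul_of_domain (linPoly _),
      Polynomial.coe_mul, coe_reverse_linPoly (hb _), map_neg] at e2
    rw [← e1] at e2
    apply mul_right_cancel₀ (mul_ne_zero hD' (mul_ne_zero
      (linFactor_ne_zero (evPt q a r (k + 1))⁻¹) (linFactor_ne_zero (evPt q a r k)⁻¹)))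
    rw [phiMinusLog, map_mul, map_mul]
    linear_combination e2 - PowerSeries.C (evPt q a r 0) * PowerSeries.C (evPt q a r (r + 1)) *
      ((polyQ q a r k * qShift q (polyR q a r k) : ℂ[X]).reverse : PowerSeries ℂ) * e3
  have h0 : (q : ℂ) ≠ 0 := q.ne_zero
  have ha : (a : ℂ) ≠ 0 := a.ne_zero
  have hc : (q : ℂ) ^ ((r : ℤ) - 2 * k) * (evPt q a r 0 * evPt q a r (r + 1)) =
      (q : ℂ) ^ (-((r : ℤ) - 2 * k)) * (evPt q a r (k + 1) * evPt q a r k) := by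
    have e0 := evPt_natCast (q := q) a r 0
    rw [Nat.cast_zero] at e0
    rw [zpow_neg, zpow_weight, e0, evPt_natCast_succ, evPt_natCast, evPt_natCast_succ, pow_zero]
    field_simp
  ext n
  have h2 := congrArg (PowerSeries.coeff n) h1
  rw [PowerSeries.coeff_C_mul, PowerSeries.coeff_C_mul, PowerSeries.coeff_mk] at h2
  rw [psiMinus, natDegree_polyQ, natDegree_polyR, PowerSeries.coeff_smul, PowerSeries.coeff_mk,
    phiMinusEig_eq a r hq, smul_eq_mul, show (((r - k : ℕ) : ℤ) - k) = r - 2 * k by omega]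
  apply mul_left_cancel₀ (mul_ne_zero (hb (k + 1)) (hb k))
  linear_combination (q : ℂ) ^ ((r : ℤ) - 2 * k) * h2 + expCoeff (phiMinusLog q a r k) n * hc

end Weights

/-! ### Coordinates in the basis `v_0, …, v_r` -/

section Coordinates

variable {r : ℕ}

theorem spinVec_apply (j : ℕ) (i : Fin (r + 1)) :
    spinVec r j i = if j = (i : ℕ) then 1 else 0 := by
  by_cases h : j < r + 1
  · rw [spinVec, dif_pos h, Pi.single_apply]
    simp only [Fin.ext_iff, eq_comm]
  · have := i.isLt
    rw [spinVec_eq_zero h, if_neg (by omega), Pi.zero_apply]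

theorem spinVec_ne_zero {j : ℕ} (h : j < r + 1) : spinVec r j ≠ 0 := fun h0 => by
  simpa [spinVec_apply] using congrFun h0 ⟨j, h⟩

theorem eq_top_of_spinVec_mem {W : Submodule ℂ (SpinSpace r)}
    (h : ∀ j < r + 1, spinVec r j ∈ W) : W = ⊤ := by
  rw [eq_top_iff, ← (Pi.basisFun ℂ (Fin (r + 1))).span_eq, Submodule.span_le]
  rintro _ ⟨⟨j, hj⟩, rfl⟩
  rw [← spinVec_eq_basis hj]
  exact h j hj

theorem linearMap_spin_ext {M : Type*} [AddCommGroup M] [Module ℂ M] {f g : SpinSpace r →ₗ[ℂ] M}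
    (h : ∀ j < r + 1, f (spinVec r j) = g (spinVec r j)) : f = g := by
  apply (Pi.basisFun ℂ (Fin (r + 1))).ext
  rintro ⟨j, hj⟩
  rw [← spinVec_eq_basis hj]
  exact h j hj

theorem diagonal_apply {T : Module.End ℂ (SpinSpace r)} {c : ℕ → ℂ}
    (h : ∀ j, T (spinVec r j) = c j • spinVec r j) (v : SpinSpace r) (i : Fin (r + 1)) :
    T v i = c i * v i := by
  have : LinearMap.proj i ∘ₗ T = c i • (LinearMap.proj i : SpinSpace r →ₗ[ℂ] ℂ) := by
    apply linearMap_spin_ext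
    intro j _
    simp only [LinearMap.comp_apply, LinearMap.proj_apply, LinearMap.smul_apply, h, Pi.smul_apply,
      smul_eq_mul, spinVec_apply]
    split_ifs with hj <;> simp [hj]
  exact LinearMap.congr_fun this v

/-- Reduces generalised eigenvectors of a diagonal operator to a scalar condition on each
coordinate. -/
theorem diagonal_sub_pow_apply {T : Module.End ℂ (SpinSpace r)} {c : ℕ → ℂ}
    (h : ∀ j, T (spinVec r j) = c j • spinVec r j) (d : ℂ) (p : ℕ) (v : SpinSpace r)
    (i : Fin (r + 1)) : ((T - algebraMap ℂ _ d) ^ p) v i = (c i - d) ^ p * v i := by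
  induction p with
  | zero => simp
  | succ p ih =>
    rw [pow_succ', Module.End.mul_apply, LinearMap.sub_apply, Pi.sub_apply, diagonal_apply h,
      Module.algebraMap_end_apply, Pi.smul_apply, smul_eq_mul, ih]
    ring

end Coordinates

/-! ### Loop-weight spaces of the evaluation representation -/

section LoopWeights

variable {q : ℂˣ} (a : ℂˣ) (r : ℕ) (hq : ∀ n : ℕ, 0 < n → q ^ n ≠ 1)

theorem evalRep_phiPlus (k n : ℕ) : evalRep a r hq (phiPlus q n) (spinVec r k) =
    phiPlusEig q a r k n • spinVec r k := by
  rw [phiPlus, evalRep_toUqAff, lift_phiPlusFree a r hq]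

theorem evalRep_phiMinus (k n : ℕ) : evalRep a r hq (phiMinus q (-n)) (spinVec r k) =
    phiMinusEig q a r k n • spinVec r k := by
  rw [phiMinus, evalRep_toUqAff, lift_phiMinusFree a r hq]

/-- A power of a scalar vanishes only if the scalar does, so each nonzero coordinate forces its own
pair of series; conversely the exponent `1` suffices. -/
theorem mem_loopWeightSpace_evalRep {Ψp Ψm : PowerSeries ℂ} {v : SpinSpace r} :
    v ∈ loopWeightSpace (evalRep a r hq) Ψp Ψm ↔ ∀ i : Fin (r + 1), v i ≠ 0 →
      Ψp = PowerSeries.mk (phiPlusEig q a r i) ∧ Ψm = PowerSeries.mk (phiMinusEig q a r i) := by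
  constructor
  · rintro ⟨p, hp⟩ i hi
    constructor
    · ext n
      have := congrFun (hp n).1 i
      rw [diagonal_sub_pow_apply (fun k => evalRep_phiPlus a r hq k n), Pi.zero_apply] at this
      rw [PowerSeries.coeff_mk]
      exact (sub_eq_zero.mp (eq_zero_of_pow_eq_zero
        ((mul_eq_zero.mp this).resolve_right hi))).symm
    · ext n
      have := congrFun (hp n).2 i
      rw [diagonal_sub_pow_apply (fun k => evalRep_phiMinus a r hq k n), Pi.zero_apply] at this
      rw [PowerSeries.coeff_mk]
      exact (sub_eq_zero.mp (eq_zero_of_pow_eq_zero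
        ((mul_eq_zero.mp this).resolve_right hi))).symm
  · intro h
    refine ⟨1, fun n => ⟨?_, ?_⟩⟩
    · ext i
      rw [diagonal_sub_pow_apply (fun k => evalRep_phiPlus a r hq k n), pow_one, Pi.zero_apply]
      by_cases hi : v i = 0
      · rw [hi, mul_zero]
      · rw [(h i hi).1, PowerSeries.coeff_mk, sub_self, zero_mul]
    · ext i
      rw [diagonal_sub_pow_apply (fun k => evalRep_phiMinus a r hq k n), pow_one, Pi.zero_apply]
      by_cases hi : v i = 0
      · rw [hi, mul_zero]
      · rw [(h i hi).2, PowerSeries.coeff_mk, sub_self, zero_mul]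

/-- The constant term `q^{r-2k}` already separates the weights, as `q` is not a root of unity. -/
theorem phiPlusEig_injective (hq : ∀ n : ℕ, 0 < n → q ^ n ≠ 1) {j k : ℕ}
    (h : PowerSeries.mk (phiPlusEig q a r j) = PowerSeries.mk (phiPlusEig q a r k)) : j = k := by
  have h0 := congrArg (PowerSeries.coeff 0) h
  rw [PowerSeries.coeff_mk, PowerSeries.coeff_mk, phiPlusEig_eq a r hq, phiPlusEig_eq a r hq,
    expCoeff_zero, expCoeff_zero, mul_one, mul_one] at h0
  have := zpow_left_injective hq h0
  omega

theorem loopWeightSpaceOf_evalRep {k : ℕ} (hk : k ≤ r) :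
    loopWeightSpaceOf (evalRep a r hq) (polyQ q a r k) (polyR q a r k) =
      Submodule.span ℂ {spinVec r k} := by
  rw [loopWeightSpaceOf, psiPlus_polyQ_polyR a r hq hk, psiMinus_polyQ_polyR a r hq hk]
  ext v
  rw [mem_loopWeightSpace_evalRep, Submodule.mem_span_singleton]
  constructor
  · intro h
    refine ⟨v ⟨k, by omega⟩, ?_⟩
    ext i
    rw [Pi.smul_apply, spinVec_apply, smul_eq_mul]
    split_ifs with hi
    · rw [mul_one]
      congr 1
      exact Fin.ext hi
    · rw [mul_zero]
      by_contra h0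
      exact hi (phiPlusEig_injective a r hq (h i (Ne.symm h0)).1)
  · rintro ⟨c, rfl⟩ i hi
    rw [Pi.smul_apply, spinVec_apply] at hi
    split_ifs at hi with h
    · rw [h]
      exact ⟨rfl, rfl⟩
    · simp at hi

theorem mul_polyR_eq_polyQ_mul {k : ℕ} (hk : k ≤ r) {Q R : ℂ[X]} (hQ : Q.coeff 0 = 1)
    (hR : R.coeff 0 = 1)
    (h : loopWeightSpaceOf (evalRep a r hq) Q R = Submodule.span ℂ {spinVec r k}) :
    Q * polyR q a r k = polyQ q a r k * R := by
  apply mul_eq_mul_of_psiPlus_eq hq hQ hR (coeff_zero_polyQ q a r k) (coeff_zero_polyR q a r k)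
  have hmem : spinVec r k ∈ loopWeightSpaceOf (evalRep a r hq) Q R := by
    rw [h]
    exact Submodule.mem_span_singleton_self _
  rw [psiPlus_polyQ_polyR a r hq hk]
  exact ((mem_loopWeightSpace_evalRep a r hq).mp hmem ⟨k, by omega⟩ (by simp [spinVec_apply])).1

theorem exists_of_loopWeightSpace_ne_bot {Ψp Ψm : PowerSeries ℂ}
    (h : loopWeightSpace (evalRep a r hq) Ψp Ψm ≠ ⊥) : ∃ k : ℕ, k ≤ r ∧
      Ψp = psiPlus q (polyQ q a r k) (polyR q a r k) ∧
      Ψm = psiMinus q (polyQ q a r k) (polyR q a r k) := by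
  obtain ⟨v, hv, hv0⟩ := (Submodule.ne_bot_iff _).mp h
  obtain ⟨i, hi⟩ := Function.ne_iff.mp hv0
  have hk : (i : ℕ) ≤ r := by omega
  refine ⟨i, hk, ?_⟩
  rw [psiPlus_polyQ_polyR a r hq hk, psiMinus_polyQ_polyR a r hq hk]
  exact (mem_loopWeightSpace_evalRep a r hq).mp hv i hi

theorem isTypeOne_evalRep : IsTypeOne (evalRep a r hq) := by
  have h' := isEvaluationRep_evalRep a r hq
  refine ⟨h'.Chalf, eq_top_of_spinVec_mem fun j _ => ?_, eq_top_of_spinVec_mem fun j _ => ?_⟩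
  · apply Submodule.mem_iSup_of_mem (-((r : ℤ) - 2 * j))
    rw [Module.End.mem_eigenspace_iff, h'.chevalley, jimboEv, spinRep_sl2Gen, spinGen_Kinv]
  · apply Submodule.mem_iSup_of_mem ((r : ℤ) - 2 * j)
    rw [Module.End.mem_eigenspace_iff, h'.chevalley, jimboEv, spinRep_sl2Gen, spinGen_K]

end LoopWeights

/-! ### Irreducibility and the Drinfeld polynomial -/

section Irreducible

/-- The orbit of `v` is an invariant subspace containing `v`. -/
theorem IsIrreducibleRep.exists_apply_eq {q : ℂˣ} {V : Type*} [AddCommGroup V] [Module ℂ V]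
    {ρ : UqAff q →ₐ[ℂ] Module.End ℂ V} (h : IsIrreducibleRep ρ) {v : V} (hv : v ≠ 0) (w : V) :
    ∃ x : UqAff q, ρ x v = w := by
  let W : Submodule ℂ V := LinearMap.range (LinearMap.applyₗ v ∘ₗ ρ.toLinearMap)
  have hW : W = ⊤ := by
    refine (h.eq_bot_or_eq_top W ?_).resolve_left fun h0 => hv ?_
    · rintro x _ ⟨y, rfl⟩
      exact ⟨x * y, by simp⟩
    · rw [← Submodule.mem_bot ℂ, ← h0]
      exact ⟨1, by simp⟩
  obtain ⟨x, hx⟩ : w ∈ W := hW ▸ Submodule.mem_top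
  exact ⟨x, hx⟩

variable {q : ℂˣ} (a : ℂˣ) (r : ℕ)

theorem evalGen_Xp_zero_apply_castSucc (v : SpinSpace r) (i : Fin r) :
    evalGen q a r (.Xp 0) v i.castSucc = qInt q (r - (i : ℕ)) * v i.succ := by
  have : LinearMap.proj i.castSucc ∘ₗ evalGen q a r (.Xp 0) =
      qInt q (r - (i : ℕ)) • (LinearMap.proj i.succ : SpinSpace r →ₗ[ℂ] ℂ) := by
    apply linearMap_spin_ext
    intro j _
    simp only [LinearMap.comp_apply, LinearMap.proj_apply, LinearMap.smul_apply, smul_eq_mul]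
    rcases j with _ | j
    · simp [evalGen_Xp_zero, spinVec_apply]
    · rw [evalGen_Xp_succ, Pi.smul_apply, smul_eq_mul, zpow_zero, one_mul, spinVec_apply,
        spinVec_apply]
      by_cases hj : j = i <;> simp [hj]
  exact LinearMap.congr_fun this v

theorem evalGen_Xp_zero_apply_last (v : SpinSpace r) :
    evalGen q a r (.Xp 0) v (Fin.last r) = 0 := by
  have : LinearMap.proj (Fin.last r) ∘ₗ evalGen q a r (.Xp 0) = (0 : SpinSpace r →ₗ[ℂ] ℂ) := by
    apply linearMap_spin_ext
    intro j hj
    simp only [LinearMap.comp_apply, LinearMap.proj_apply]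
    rcases j with _ | j
    · simp [evalGen_Xp_zero]
    · rw [evalGen_Xp_succ, Pi.smul_apply, spinVec_apply, if_neg (by rw [Fin.val_last]; omega)]
      simp
  exact LinearMap.congr_fun this v

theorem eq_smul_spinVec_zero {v : SpinSpace r} (h : ∀ i : Fin r, v i.succ = 0) :
    v = v 0 • spinVec r 0 := by
  ext i
  rw [Pi.smul_apply, spinVec_apply]
  refine Fin.cases ?_ (fun i => ?_) i
  · simp
  · simp [h]

variable (hq : ∀ n : ℕ, 0 < n → q ^ n ≠ 1)

/-- The kernel of `X⁺_0` is spanned by `v_0`. -/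
theorem eq_smul_spinVec_zero_of_Xp_eq_zero (hq : ∀ n : ℕ, 0 < n → q ^ n ≠ 1) {v : SpinSpace r}
    (h : evalGen q a r (.Xp 0) v = 0) :
    v = v 0 • spinVec r 0 := by
  apply eq_smul_spinVec_zero
  intro i
  have hi := evalGen_Xp_zero_apply_castSucc (q := q) a r v i
  rw [h, Pi.zero_apply, zero_eq_mul] at hi
  exact hi.resolve_left (qInt_ne_zero hq (by omega))

/-- Induction on a bound `k` for the support: `X⁺_0` lowers it by one, and a vector it kills is
already a multiple of `v_0`. -/
theorem spinVec_zero_mem {W : Submodule ℂ (SpinSpace r)}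
    (hW : ∀ x : UqAff q, ∀ w ∈ W, evalRep a r hq x w ∈ W) (k : ℕ) :
    ∀ w ∈ W, w ≠ 0 → (∀ i : Fin (r + 1), k < i → w i = 0) → spinVec r 0 ∈ W := by
  have hmul : ∀ w ∈ W, w ≠ 0 → w = w 0 • spinVec r 0 → spinVec r 0 ∈ W := by
    intro w hw h0 h
    have hc : w 0 ≠ 0 := fun hc => h0 (by rw [h, hc, zero_smul])
    rw [h] at hw
    exact (Submodule.smul_mem_iff W hc).mp hw
  induction k with
  | zero =>
    intro w hw h0 h
    exact hmul w hw h0 (eq_smul_spinVec_zero r fun i => h _ (by simp))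
  | succ k ih =>
    intro w hw h0 h
    by_cases hX : evalGen q a r (.Xp 0) w = 0
    · exact hmul w hw h0 (eq_smul_spinVec_zero_of_Xp_eq_zero a r hq hX)
    · have hmem := hW (loopGen q (.Xp 0)) w hw
      rw [evalRep_loopGen] at hmem
      refine ih _ hmem hX fun i => ?_
      refine Fin.lastCases (fun _ => evalGen_Xp_zero_apply_last a r w) (fun i hi => ?_) i
      rw [evalGen_Xp_zero_apply_castSucc, h i.succ (by simpa using hi), mul_zero]

/-- A nonzero invariant subspace contains `v_0`; from there `X⁻_0` reaches every `v_j`, since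
`[j+1]_q ≠ 0`. -/
theorem isIrreducibleRep_evalRep : IsIrreducibleRep (evalRep a r hq) := by
  refine ⟨inferInstance, fun W hW => or_iff_not_imp_left.mpr fun hne => ?_⟩
  obtain ⟨w, hw, hw0⟩ := (Submodule.ne_bot_iff _).mp hne
  have h0 := spinVec_zero_mem a r hq hW r w hw hw0 fun i hi => by omega
  apply eq_top_of_spinVec_mem
  intro j _
  induction j with
  | zero => exact h0
  | succ j ih =>
    have := hW (loopGen q (.Xm 0)) _ (ih (by omega))
    rw [evalRep_loopGen, evalGen_Xm, zpow_zero, one_mul] at this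
    exact (Submodule.smul_mem_iff W (qInt_ne_zero hq (by omega))).mp this

theorem isHighestWeightVector_spinVec_zero :
    IsHighestWeightVector (evalRep a r hq) (spinVec r 0) where
  ne_zero := spinVec_ne_zero r.succ_pos
  generates := (isIrreducibleRep_evalRep a r hq).exists_apply_eq (spinVec_ne_zero r.succ_pos)
  Xp n := by rw [evalRep_loopGen, evalGen_Xp_zero]
  K := ⟨_, by rw [evalRep_loopGen, evalGen, spinGen_K]⟩
  H n hn := ⟨_, by rw [evalRep_loopGen, evalGen_H]⟩

theorem psiPlus_one (q : ℂˣ) (P : ℂ[X]) :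
    psiPlus q P 1 = (q : ℂ) ^ P.natDegree • expandZero (qShift q P) P := by
  simp [psiPlus, qShift_one]

theorem psiMinus_one (q : ℂˣ) (P : ℂ[X]) :
    psiMinus q P 1 = (q : ℂ) ^ P.natDegree • expandInfty (qShift q P) P := by
  simp [psiMinus, qShift_one]

/-- Every highest weight vector is a multiple of `v_0`, and the Drinfeld series of `P` is the
loop-weight series of the pair `(P, 1)`, which determines `P`. -/
theorem isDrinfeldPolynomial_evalRep_iff (P : ℂ[X]) :
    IsDrinfeldPolynomial (evalRep a r hq) P ↔ P = polyQ q a r 0 := by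
  have hp := psiPlus_polyQ_polyR a r hq r.zero_le
  have hm := psiMinus_polyQ_polyR a r hq r.zero_le
  rw [polyR_zero] at hp hm
  constructor
  · intro h
    obtain ⟨v, hv, hphi⟩ := h.exists_highest
    have hX := hv.Xp 0
    rw [evalRep_loopGen] at hX
    have hv0 := eq_smul_spinVec_zero_of_Xp_eq_zero a r hq hX
    have heq : psiPlus q P 1 = psiPlus q (polyQ q a r 0) 1 := by
      rw [hp, psiPlus_one]
      ext n
      have h1 := (hphi n).1
      have h2 : evalRep a r hq (phiPlus q n) v = phiPlusEig q a r 0 n • v := by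
        rw [hv0, map_smul, evalRep_phiPlus, smul_comm]
      rw [h2] at h1
      rw [PowerSeries.coeff_mk]
      exact (smul_left_injective ℂ hv.ne_zero h1).symm
    have := mul_eq_mul_of_psiPlus_eq hq h.coeff_zero coeff_one_zero (coeff_zero_polyQ q a r 0)
      coeff_one_zero heq
    rwa [mul_one, mul_one] at this
  · rintro rfl
    refine ⟨isTypeOne_evalRep a r hq, isIrreducibleRep_evalRep a r hq, coeff_zero_polyQ q a r 0,
      spinVec r 0, isHighestWeightVector_spinVec_zero a r hq, fun n => ?_⟩
    rw [← psiPlus_one, ← psiMinus_one, hp, hm, PowerSeries.coeff_mk, PowerSeries.coeff_mk]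
    exact ⟨evalRep_phiPlus a r hq 0 n, evalRep_phiMinus a r hq 0 n⟩

end Irreducible

end QAff

end

theorem mainTheorem5 (q a : ℂˣ) (hq : ∀ n : ℕ, 0 < n → q ^ n ≠ 1) (r : ℕ) :
    (∃! ρ : QAff.UqAff q →ₐ[ℂ] Module.End ℂ (QAff.SpinSpace r), QAff.IsEvaluationRep q a r ρ) ∧
    ∀ ρ : QAff.UqAff q →ₐ[ℂ] Module.End ℂ (QAff.SpinSpace r), QAff.IsEvaluationRep q a r ρ →
      QAff.IsTypeOne ρ ∧
      (∀ k : ℕ, k ≤ r →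
        (QAff.polyQ q a r k).coeff 0 = 1 ∧ (QAff.polyR q a r k).coeff 0 = 1 ∧
        QAff.spinVec r k ≠ 0 ∧
        QAff.loopWeightSpaceOf ρ (QAff.polyQ q a r k) (QAff.polyR q a r k)
          = Submodule.span ℂ {QAff.spinVec r k} ∧
        ∀ Q R : Polynomial ℂ, Q.coeff 0 = 1 → R.coeff 0 = 1 →
          QAff.loopWeightSpaceOf ρ Q R = Submodule.span ℂ {QAff.spinVec r k} →
          Q * QAff.polyR q a r k = QAff.polyQ q a r k * R) ∧
      (∀ Ψp Ψm : PowerSeries ℂ, QAff.loopWeightSpace ρ Ψp Ψm ≠ ⊥ →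
        ∃ k : ℕ, k ≤ r ∧
          Ψp = QAff.psiPlus q (QAff.polyQ q a r k) (QAff.polyR q a r k) ∧
          Ψm = QAff.psiMinus q (QAff.polyQ q a r k) (QAff.polyR q a r k)) ∧
      (∀ P : Polynomial ℂ, QAff.IsDrinfeldPolynomial ρ P ↔
        P = ∏ k ∈ Finset.Icc 1 r,
          (1 - Polynomial.C ((q : ℂ) ^ ((r : ℤ) - 2 * k + 1) * (a : ℂ)) * Polynomial.X)) := by
  refine ⟨⟨QAff.evalRep a r hq, QAff.isEvaluationRep_evalRep a r hq,
    fun ρ hρ => QAff.eq_evalRep hq hρ⟩, fun ρ hρ => ?_⟩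
  obtain rfl := QAff.eq_evalRep hq hρ
  exact ⟨QAff.isTypeOne_evalRep a r hq,
    fun k hk => ⟨QAff.coeff_zero_polyQ q a r k, QAff.coeff_zero_polyR q a r k,
      QAff.spinVec_ne_zero (by omega), QAff.loopWeightSpaceOf_evalRep a r hq hk,
      fun Q R hQ hR h => QAff.mul_polyR_eq_polyQ_mul a r hq hk hQ hR h⟩,
    fun Ψp Ψm h => QAff.exists_of_loopWeightSpace_ne_bot a r hq h,
    fun P => QAff.isDrinfeldPolynomial_evalRep_iff a r hq P⟩
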